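/- Let $d\ge 2$ and let $D\subseteq\mathbb R^d$ be a domain (a non-empty connected open set), with closure $\overline D$ and boundary $\partial D$; $B(x,\rho)$ denotes the open Euclidean ball. Assume: * (uniform exterior sphere condition) there is $r>0$ such that for every $x\in\partial D$ the set $\mathcal N_{x,r}=\{\nu:|\nu|=1,\ B(x+r\nu,r)\cap D=\emptyset\}$ is non-empty and $\mathcal N_{x,r}=\mathcal N_{x,s}$ for all $0<s\le r$; * (uniform interior cone condition) there are $\delta>0$ and $\alpha\in(0,\pi/2]$ such that for every $x\in\partial D$ there is a unit vector $m$ for which $\big(y+\{z:\langle z,m\rangle>|z|\cos\alpha\}\big)\cap B(x,\delta)\subseteq D$ for all $y\in D\cap B(x,\delta)$; * ($D$ is $\mathrm{CAT}(0)$) let $d_I(x,y)$, $x,y\in D$, be the infimum of the Euclidean lengths of smooth paths in $D$ from $x$ to $y$, extended by continuity to $\overline D\times\overline D$. A unit-speed intrinsic geodesic from $a$ to $b$ is a path $\Gamma:[0,L]\to\overline D$ with $\Gamma(0)=a$, $\Gamma(L)=b$ and $d_I(\Gamma(s),\Gamma(t))=|s-t|$ for all $s,t\in[0,L]$. For every triangle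 of unit-speed intrinsic geodesics $\Gamma_{a,b},\Gamma_{a,c},\Gamma_{b,c}$ with vertices $a,b,c\in D$, the distance $d_I(\Gamma_{a,b}(s),\Gamma_{a,c}(t))$ is at most the distance between the points at distance $s$, respectively $t$, from $\tilde a$ along the sides $\tilde a\tilde b$, respectively $\tilde a\tilde c$, of a Euclidean triangle $\tilde a\tilde b\tilde c$ with the same side lengths. For distinct $x,y\in\overline D$ let $\chi(x,y)$ be the derivative at $x$ of the unit-speed intrinsic geodesic from $x$ to $y$. A driving path is a càdlàg path $y:[0,\infty)\to\overline D$ of bounded variation on finite intervals. A weak solution of $dx=\chi(x,y)\,dt$ on $[0,T]$ is an absolutely continuous path $x:[0,T]\to\overline D$ such that $s\mapsto\chi(x(s),y(s))$ is integrable on $[0,T]$ and $x(t)=x(0)+\int_0^t\chi(x(s),y(s))\,ds$ for all $t\in[0,T]$. A solution up to the first meeting time is a pair $(x,\tau)$, $\tau\in[0,\infty]$, such that $x$ is a weak solution on $[0,T]$ for every finite $T\le\tau$, $x(t)\ne y(t)$ for $0\le t<\tau$, and $x(\tau)=y(\tau)$ if $\tau<\infty$. Then: 1. The field $\chi$ is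 well defined: for distinct $x,y\in\overline D$ there is exactly one unit-speed intrinsic geodesic from $x$ to $y$, it has a one-sided derivative $\chi(x,y)$ at its starting point, and $|\chi(x,y)|=1$. 2. (Existence and uniqueness) For every driving path $y$ and every $x_0\in\overline D$ there is a solution $(x,\tau)$ up to the first meeting time with $x(0)=x_0$. Moreover, if $z$ is a weak solution on some $[0,T]$ with $z(0)=x_0$ and $z(t)\ne y(t)$ for $0\le t<T$, then $T\le\tau$ and $z=x$ on $[0,T]$; in particular $(x,\tau)$ is unique. 3. (Continuous dependence) Let $y$ be a driving path and $(x,\tau)$ a solution up to the first meeting time. For all $T\ge0$ and $\varepsilon>0$ there is $\delta>0$ such that, for every driving path $y'$ and every solution $(x',\tau')$ of $dx'=\chi(x',y')\,dt$ up to the first meeting time of $x'$ and $y'$, if $|x'(0)-x(0)|<\delta$ and $|y'(t)-y(t)|<\delta$ for all $t\in[0,T]$, then $|x'(t)-x(t)|<\varepsilon$ for all $t\in[0,T]$ with $t\le\tau$ and $t\le\tau'$; and if moreover $T<\tau$ and $x(t)\ne y(t-)$ for all $t\in(0,T]$, then $T<\tau'$. -/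

import Mathlib

open Set Filter Topology MeasureTheory
open scoped ENNReal ContDiff

/-! ### Boundary regularity -/

/-- The exterior normals `𝒩_{x,r}` at `x`: unit vectors `ν` such that the open Euclidean ball of
radius `r` about `x + r ν` does not meet `D`. -/
def exteriorNormals {d : ℕ} (D : Set (EuclideanSpace ℝ (Fin d)))
    (x : EuclideanSpace ℝ (Fin d)) (r : ℝ) : Set (EuclideanSpace ℝ (Fin d)) :=
  {ν | ‖ν‖ = 1 ∧ Metric.ball (x + r • ν) r ∩ D = ∅}

/-- Uniform exterior sphere condition based on radius `r`. -/
def UniformExteriorSphere {d : ℕ} (D : Set (EuclideanSpace ℝ (Fin d))) (r : ℝ) : Prop :=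
  0 < r ∧ ∀ x ∈ frontier D, (exteriorNormals D x r).Nonempty ∧
    ∀ s : ℝ, 0 < s → s ≤ r → exteriorNormals D x r = exteriorNormals D x s

/-- Uniform interior cone condition based on radius `δ` and angle `α ∈ (0, π/2]`: the point `y + z`
below runs over `(y + C(m)) ∩ ball x δ` with `C(m) = {z | ⟪z, m⟫ > ‖z‖ cos α}`. -/
def UniformInteriorCone {d : ℕ} (D : Set (EuclideanSpace ℝ (Fin d))) (δ α : ℝ) : Prop :=
  0 < δ ∧ 0 < α ∧ α ≤ Real.pi / 2 ∧
  ∀ x ∈ frontier D, ∃ m : EuclideanSpace ℝ (Fin d), ‖m‖ = 1 ∧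
    ∀ y ∈ D ∩ Metric.ball x δ, ∀ z : EuclideanSpace ℝ (Fin d),
      ‖z‖ * Real.cos α < inner ℝ z m → y + z ∈ Metric.ball x δ → y + z ∈ D

/-! ### Intrinsic metric, geodesics, CAT(0) -/

/-- Intrinsic distance between two points of `D`: the infimum of the Euclidean lengths of the smooth
paths in `D` that join them. -/
noncomputable def intrinsicDist {d : ℕ} (D : Set (EuclideanSpace ℝ (Fin d)))
    (x y : EuclideanSpace ℝ (Fin d)) : ℝ≥0∞ :=
  ⨅ γ ∈ {γ : ℝ → EuclideanSpace ℝ (Fin d) | ContDiffOn ℝ ∞ γ (Icc 0 1) ∧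
      MapsTo γ (Icc 0 1) D ∧ γ 0 = x ∧ γ 1 = y},
    eVariationOn γ (Icc 0 1)

/-- The intrinsic distance on the closure of `D`, as the extension by continuity of the intrinsic
distance on `D` (when the completion of `D` is identified with its Euclidean closure). -/
noncomputable def closureDist {d : ℕ} (D : Set (EuclideanSpace ℝ (Fin d)))
    (x y : EuclideanSpace ℝ (Fin d)) : ℝ≥0∞ :=
  extendFrom (D ×ˢ D)
    (fun p : EuclideanSpace ℝ (Fin d) × EuclideanSpace ℝ (Fin d) => intrinsicDist D p.1 p.2) (x, y)

/-- `Γ`, restricted to `[0, L]`, is a unit-speed (minimal) intrinsic geodesic for `D` from `a` to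
`b`. It lies in the closure of `D`, and `L` is the intrinsic distance from `a` to `b`. -/
structure IsIntrinsicGeodesic {d : ℕ} (D : Set (EuclideanSpace ℝ (Fin d)))
    (Γ : ℝ → EuclideanSpace ℝ (Fin d)) (L : ℝ) (a b : EuclideanSpace ℝ (Fin d)) : Prop where
  nonneg : 0 ≤ L
  left : Γ 0 = a
  right : Γ L = b
  mem : ∀ t ∈ Icc 0 L, Γ t ∈ closure D
  dist_eq : ∀ s ∈ Icc 0 L, ∀ t ∈ Icc 0 L, closureDist D (Γ s) (Γ t) = ENNReal.ofReal |s - t|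

/-- `D` is a CAT(0) domain: for every geodesic triangle with vertices `a b c` in `D`, and every
Euclidean triangle `a' b' c'` with the same side lengths, the point at distance `s` from `a` along
`Γab` and the point at distance `t` from `a` along `Γac` are at most as far apart as the
corresponding points `p`, `q` of the Euclidean triangle. -/
def IsCAT0Domain {d : ℕ} (D : Set (EuclideanSpace ℝ (Fin d))) : Prop :=
  ∀ a ∈ D, ∀ b ∈ D, ∀ c ∈ D, ∀ (Γab Γac Γbc : ℝ → EuclideanSpace ℝ (Fin d)) (Lab Lac Lbc : ℝ),
    IsIntrinsicGeodesic D Γab Lab a b → IsIntrinsicGeodesic D Γac Lac a c →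
    IsIntrinsicGeodesic D Γbc Lbc b c →
    ∀ a' b' c' : EuclideanSpace ℝ (Fin 2),
      dist a' b' = Lab → dist a' c' = Lac → dist b' c' = Lbc →
      ∀ s ∈ Icc 0 Lab, ∀ t ∈ Icc 0 Lac,
        ∀ p ∈ segment ℝ a' b', ∀ q ∈ segment ℝ a' c', dist a' p = s → dist a' q = t →
          closureDist D (Γab s) (Γac t) ≤ ENNReal.ofReal (dist p q)

/-! ### The pursuit equation -/

/-- The vector field `χ(x, y)`: the tangent vector at `x` of the unit-speed intrinsic geodesic from
`x` to `y` (a junk value is taken if there is none). -/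
noncomputable def chi {d : ℕ} (D : Set (EuclideanSpace ℝ (Fin d)))
    (x y : EuclideanSpace ℝ (Fin d)) : EuclideanSpace ℝ (Fin d) :=
  Classical.epsilon fun v => ∃ (Γ : ℝ → EuclideanSpace ℝ (Fin d)) (L : ℝ),
    IsIntrinsicGeodesic D Γ L x y ∧ HasDerivWithinAt Γ v (Icc 0 L) 0

/-- A driving path `y(t)`, `t ≥ 0`: a cadlag path in the closure of `D`, of bounded variation on
finite intervals. -/
structure IsDrivingPath {d : ℕ} (D : Set (EuclideanSpace ℝ (Fin d)))
    (y : ℝ → EuclideanSpace ℝ (Fin d)) : Prop where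
  mem : ∀ t, 0 ≤ t → y t ∈ closure D
  rightCont : ∀ t, 0 ≤ t → ContinuousWithinAt y (Ici t) t
  leftLim : ∀ t, 0 < t → ∃ l, Tendsto y (𝓝[<] t) (𝓝 l)
  boundedVar : LocallyBoundedVariationOn y (Ici 0)

/-- `x` is, on `[0, T]`, an absolutely continuous path in the closure of `D` that is a weak solution
of `dx = χ(x, y) dt`. -/
structure IsWeakSolution {d : ℕ} (D : Set (EuclideanSpace ℝ (Fin d)))
    (y x : ℝ → EuclideanSpace ℝ (Fin d)) (T : ℝ) : Prop where
  mem : ∀ t ∈ Icc 0 T, x t ∈ closure D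
  absCont : AbsolutelyContinuousOnInterval x 0 T
  integrable : IntervalIntegrable (fun s => chi D (x s) (y s)) volume 0 T
  eqn : ∀ t ∈ Icc 0 T, x t = x 0 + ∫ s in (0 : ℝ)..t, chi D (x s) (y s)

/-- `x` is a weak solution up to the time `τ ∈ [0, ∞]`, and `τ` is the first time at which `x` and
`y` are equal (`τ = ∞` if this never happens). -/
structure IsPursuitPath {d : ℕ} (D : Set (EuclideanSpace ℝ (Fin d)))
    (y x : ℝ → EuclideanSpace ℝ (Fin d)) (τ : ℝ≥0∞) : Prop where
  sol : ∀ T : ℝ, 0 ≤ T → ENNReal.ofReal T ≤ τ → IsWeakSolution D y x T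
  ne_before : ∀ t : ℝ, 0 ≤ t → ENNReal.ofReal t < τ → x t ≠ y t
  eq_at : ∀ t : ℝ, 0 ≤ t → ENNReal.ofReal t = τ → x t = y t

/-!
The closure of `D` with the extension of the intrinsic distance (`IntrinsicClosure D`) is a proper
`CAT(0)` space, and the pursuit equation is solved there by metric methods. Three facts carry the
argument.

*The intrinsic distance is a cubic perturbation of the Euclidean one.* The midpoint of a chord of
length `l` is within `O(l ^ 2)` of the closure of `D`, since an exterior ball at the nearest point
contains neither end of the chord (`UniformExteriorSphere.exists_norm_sub_midpoint_le`). Repeated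
bisection through nearest points gives polygons with vertices in the closure and length at most
`l + O(l ^ 3)`, and a small translation along the axis of the interior cone moves a fine polygon
into `D` (`exists_intrinsicDist_le`). So the intrinsic distance extends to a metric on the closure,
which induces the Euclidean topology, and limits of almost minimal paths are geodesics. The
hypothesis on triangles in `D` becomes the Bruhat--Tits inequality, which is stable under limits and
thus holds in the whole closure (`IntrinsicClosure.isCAT0Space`).

*Geodesics have an initial velocity that depends continuously on their ends.* As arcs exceed chords
only cubically, a point that divides a geodesic of length `t` is within `O(t ^ 2)` of the
corresponding point of the chord. Hence the mean velocities over `[0, t]` converge, at a rate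
uniform in the end points (`norm_meanVelocity_sub_le`), so that the limit is a unit vector, and is
continuous where the end points are distinct (`tendsto_initialVelocity`). This is the field `chi`.
For a right-continuous target the integral equation is then equivalent, before the meeting, to
`chi` being the right derivative of the path at every time (`Pursues`).

*Two pursuers of the same target do not move apart.* In a `CAT(0)` space, points moving with unit
speed along geodesics to a common end point approach each other weakly
(`dist_geod_geod_le_dist`), so the distance of two solutions is nonincreasing
(`dist_le_of_pursues`). This gives uniqueness, up to the meeting time (`eqOn_of_pursues`).
Existence comes from an Euler scheme that heads, on each time step, for the position of the target
at the end of the step: the paths are `1`-Lipschitz, so they converge along an ultrafilter, and by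
the continuity of the field the limit pursues the target (`pursues_of_tendsto`,
`exists_pursuit`). The same limit argument combined with uniqueness shows that solutions with
converging data converge (`tendsto_dist_of_pursues`), which is the continuous dependence. For the
meeting times, a path that avoids the target and its left limits on `[0, T]` keeps a positive
distance from it (`exists_pos_le_dist`), hence so do all close pairs.
-/

/-! ### `CAT(0)` spaces and their geodesics -/

section CAT0Spaces

variable {X : Type*} [MetricSpace X]

/-- `z` divides the pair `a`, `b` in the ratio `l : 1 - l` and satisfies the corresponding
Bruhat--Tits (semi-parallelogram) inequality with respect to every point `p`. -/
def IsDivisionPoint (a b : X) (l : ℝ) (z : X) : Prop :=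
  ∀ p : X, dist p z ^ 2 ≤
    (1 - l) * dist p a ^ 2 + l * dist p b ^ 2 - l * (1 - l) * dist a b ^ 2

/-- A metric space is `CAT(0)` if each pair of points has division points in every ratio. These
points are unique, and form the geodesic segment between the two points. -/
def IsCAT0Space (X : Type*) [MetricSpace X] : Prop :=
  ∀ a b : X, ∀ l ∈ Icc (0 : ℝ) 1, ∃ z, IsDivisionPoint a b l z

/-- The geodesic from `a` to `b` in a `CAT(0)` space, parametrized by arc length on
`[0, dist a b]` and constant to the left and to the right of this interval. -/
noncomputable def geod (a b : X) (t : ℝ) : X :=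
  @Classical.epsilon X ⟨a⟩ (IsDivisionPoint a b (projIcc (0 : ℝ) 1 zero_le_one (t / dist a b)))

variable (hX : IsCAT0Space X)
include hX

theorem geod_isDivisionPoint (a b : X) (t : ℝ) :
    IsDivisionPoint a b (projIcc (0 : ℝ) 1 zero_le_one (t / dist a b)) (geod a b t) := by
  obtain ⟨z, hz⟩ := hX a b (projIcc (0 : ℝ) 1 zero_le_one (t / dist a b)) (Subtype.mem _)
  exact @Classical.epsilon_spec X _ ⟨z, hz⟩

/-- The `CAT(0)` inequality for the geodesic `geod a b`. It is multiplied by the length of the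
geodesic, so that it makes sense when `a = b`. -/
theorem dist_geod_sq_le (a b p : X) {t : ℝ} (ht : t ∈ Icc 0 (dist a b)) :
    dist a b * dist p (geod a b t) ^ 2 ≤
      (dist a b - t) * dist p a ^ 2 + t * dist p b ^ 2 - dist a b * (t * (dist a b - t)) := by
  rcases eq_or_lt_of_le (dist_nonneg (x := a) (y := b)) with h | h
  · obtain ⟨h1, h2⟩ := ht
    rw [← h] at h2 ⊢
    have : t = 0 := le_antisymm h2 h1
    simp [this]
  · have hmem : t / dist a b ∈ Icc (0 : ℝ) 1 := ⟨div_nonneg ht.1 h.le, (div_le_one h).2 ht.2⟩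
    have key := geod_isDivisionPoint hX a b t p
    rw [projIcc_of_mem zero_le_one hmem] at key
    have := mul_le_mul_of_nonneg_left key h.le
    refine this.trans (le_of_eq ?_)
    simp only
    field_simp

/-- A point at the right distances from the end points lies on the geodesic. -/
theorem eq_geod {a b p : X} {t : ℝ} (ht : t ∈ Icc 0 (dist a b))
    (h1 : dist p a = t) (h2 : dist p b = dist a b - t) : p = geod a b t := by
  rcases eq_or_lt_of_le (dist_nonneg (x := a) (y := b)) with h | h
  · have h0 : t = 0 := le_antisymm (by rw [h]; exact ht.2) ht.1
    have hab : a = b := dist_eq_zero.1 h.symm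
    have key := geod_isDivisionPoint hX a b t p
    have hpa : dist p a = 0 := by rw [h1, h0]
    rw [← hab] at key
    rw [hpa, dist_self] at key
    have : dist p (geod a b t) = 0 := by
      rw [← hab]
      nlinarith [dist_nonneg (x := p) (y := geod a a t)]
    exact dist_eq_zero.1 this
  · have key := dist_geod_sq_le hX a b p ht
    rw [h1, h2] at key
    have h3 : dist a b * dist p (geod a b t) ^ 2 ≤ 0 := by nlinarith
    have h4 : dist p (geod a b t) ^ 2 ≤ 0 := by
      by_contra hc
      push Not at hc
      nlinarith [mul_pos h hc]
    exact dist_eq_zero.1 (by nlinarith [dist_nonneg (x := p) (y := geod a b t)])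

theorem geod_zero (a b : X) : geod a b 0 = a :=
  (eq_geod hX ⟨le_rfl, dist_nonneg⟩ (dist_self a) (by simp)).symm

theorem geod_dist (a b : X) : geod a b (dist a b) = b :=
  (eq_geod hX ⟨dist_nonneg, le_rfl⟩ (dist_comm b a) (by simp)).symm

theorem geod_of_dist_le (a b : X) {t : ℝ} (ht : dist a b ≤ t) : geod a b t = b := by
  rcases eq_or_lt_of_le (dist_nonneg (x := a) (y := b)) with h | h
  · have : geod a b t = geod a b (dist a b) := by simp [geod, ← h]
    rw [this, geod_dist hX]
  · have : geod a b t = geod a b (dist a b) := by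
      unfold geod
      rw [projIcc_of_right_le zero_le_one ((one_le_div h).2 ht), div_self h.ne',
        projIcc_of_right_le zero_le_one le_rfl]
    rw [this, geod_dist hX]

theorem dist_geod_geod {a b : X} {s t : ℝ} (hs : s ∈ Icc 0 (dist a b))
    (ht : t ∈ Icc 0 (dist a b)) : dist (geod a b s) (geod a b t) = |s - t| := by
  rcases eq_or_lt_of_le (dist_nonneg (x := a) (y := b)) with h | h
  · have h0 : s = 0 := le_antisymm (by rw [h]; exact hs.2) hs.1
    have h1 : t = 0 := le_antisymm (by rw [h]; exact ht.2) ht.1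
    simp [h0, h1]
  -- distances to the end points are bounded above by the `CAT(0)` inequality at `p = a`, `p = b`
  have hup : ∀ u ∈ Icc 0 (dist a b), dist a (geod a b u) ≤ u ∧
      dist b (geod a b u) ≤ dist a b - u := by
    intro u hu
    have ha := dist_geod_sq_le hX a b a hu
    have hb := dist_geod_sq_le hX a b b hu
    rw [dist_self] at ha hb
    rw [dist_comm b a] at hb
    constructor
    · refine abs_le_of_sq_le_sq' ?_ hu.1 |>.2
      refine le_of_mul_le_mul_left ?_ h
      nlinarith
    · refine abs_le_of_sq_le_sq' ?_ (sub_nonneg.2 hu.2) |>.2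
      refine le_of_mul_le_mul_left ?_ h
      nlinarith
  have heq : ∀ u ∈ Icc 0 (dist a b), dist (geod a b u) a = u ∧
      dist (geod a b u) b = dist a b - u := by
    intro u hu
    obtain ⟨h1, h2⟩ := hup u hu
    have h3 := dist_triangle a (geod a b u) b
    rw [dist_comm b] at h2
    rw [dist_comm a (geod a b u)] at h1 h3
    constructor <;> linarith
  apply le_antisymm
  · have key := dist_geod_sq_le hX a b (geod a b s) ht
    rw [(heq s hs).1, (heq s hs).2] at key
    refine abs_le_of_sq_le_sq' ?_ (abs_nonneg _) |>.2
    rw [sq_abs]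
    refine le_of_mul_le_mul_left ?_ h
    nlinarith
  · have h3 := dist_triangle (geod a b s) (geod a b t) a
    have h4 := dist_triangle (geod a b t) (geod a b s) a
    rw [(heq s hs).1, (heq t ht).1] at h3 h4
    rw [dist_comm (geod a b t)] at h4
    rw [abs_le]
    constructor <;> linarith

theorem dist_geod_left {a b : X} {t : ℝ} (ht : t ∈ Icc 0 (dist a b)) :
    dist a (geod a b t) = t := by
  have := dist_geod_geod hX (⟨le_rfl, dist_nonneg⟩ : (0 : ℝ) ∈ Icc 0 (dist a b)) ht
  rw [geod_zero hX] at this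
  rw [this, zero_sub, abs_neg, abs_of_nonneg ht.1]

theorem dist_geod_right {a b : X} {t : ℝ} (ht : t ∈ Icc 0 (dist a b)) :
    dist (geod a b t) b = dist a b - t := by
  have := dist_geod_geod hX ht (⟨dist_nonneg, le_rfl⟩ : dist a b ∈ Icc 0 (dist a b))
  rw [geod_dist hX] at this
  rw [this, abs_sub_comm, abs_of_nonneg (sub_nonneg.2 ht.2)]

theorem dist_geod_geod_le {a b : X} {s t : ℝ} (hs : 0 ≤ s) (ht : 0 ≤ t) :
    dist (geod a b s) (geod a b t) ≤ |s - t| := by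
  have hmin : ∀ u, 0 ≤ u → geod a b u = geod a b (min u (dist a b)) := by
    intro u hu
    rcases le_total u (dist a b) with h | h
    · rw [min_eq_left h]
    · rw [min_eq_right h, geod_of_dist_le hX a b h, geod_dist hX]
  rw [hmin s hs, hmin t ht,
    dist_geod_geod hX ⟨le_min hs dist_nonneg, min_le_right _ _⟩
      ⟨le_min ht dist_nonneg, min_le_right _ _⟩]
  simpa using abs_min_sub_min_le_max s (dist a b) t (dist a b)

/-- The remainder of a geodesic is again a geodesic. -/
theorem geod_geod {a b : X} {s t : ℝ} (hs : 0 ≤ s) (ht : 0 ≤ t) (hst : s + t ≤ dist a b) :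
    geod (geod a b s) b t = geod a b (s + t) := by
  have hs' : s ∈ Icc 0 (dist a b) := ⟨hs, by linarith⟩
  have hst' : s + t ∈ Icc 0 (dist a b) := ⟨by linarith, hst⟩
  have hr := dist_geod_right hX hs'
  refine (eq_geod hX ⟨ht, by rw [hr]; linarith⟩ ?_ ?_).symm
  · rw [dist_geod_geod hX hst' hs', add_sub_cancel_left, abs_of_nonneg ht]
  · rw [dist_geod_right hX hst', hr]
    ring

/-- Two points that move along geodesics with unit speed towards a common target do not move
apart. -/
theorem dist_geod_geod_le_dist (x z y : X) {h : ℝ} (h0 : 0 ≤ h) (hx : h ≤ dist x y)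
    (hz : h ≤ dist z y) : dist (geod x y h) (geod z y h) ≤ dist x z := by
  rcases eq_or_lt_of_le h0 with rfl | hpos
  · rw [geod_zero hX, geod_zero hX]
  have hL : 0 < dist x y := hpos.trans_le hx
  have hL' : 0 < dist z y := hpos.trans_le hz
  have e1 := dist_geod_sq_le hX x y z ⟨h0, hx⟩
  have e2 := dist_geod_sq_le hX z y (geod x y h) ⟨h0, hz⟩
  rw [dist_geod_right hX ⟨h0, hx⟩, dist_comm (geod x y h) z] at e2
  rw [dist_comm z x] at e1
  -- the sides of the comparison triangle at the apex differ by at most the base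
  have e3 : (dist x y - dist z y) ^ 2 ≤ dist x z ^ 2 := by
    have := abs_dist_sub_le x z y
    exact sq_le_sq.2 (by rwa [abs_of_nonneg (dist_nonneg (x := x) (y := z))])
  refine abs_le_of_sq_le_sq' ?_ dist_nonneg |>.2
  refine le_of_mul_le_mul_left ?_ (mul_pos hL hL')
  set L := dist x y
  set L' := dist z y
  set a := dist x z
  set q := dist z (geod x y h)
  set D := dist (geod x y h) (geod z y h)
  have e4 : L * (L' * D ^ 2) ≤ L * ((L' - h) * q ^ 2 + h * (L - h) ^ 2 - L' * (h * (L' - h))) :=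
    mul_le_mul_of_nonneg_left e2 hL.le
  have e5 := mul_le_mul_of_nonneg_left e1 (sub_nonneg.2 hz)
  have e6 : 0 ≤ (L * L' - (L - h) * (L' - h)) * (a ^ 2 - (L - L') ^ 2) := by
    apply mul_nonneg _ (sub_nonneg.2 e3)
    nlinarith
  nlinarith

/-- Geodesics depend continuously on their end points. -/
theorem tendsto_geod {ι : Type*} {l : Filter ι} {a b : ι → X} {a₀ b₀ : X} {t : ℝ}
    (ha : Tendsto a l (𝓝 a₀)) (hb : Tendsto b l (𝓝 b₀)) (ht : t ∈ Ico 0 (dist a₀ b₀)) :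
    Tendsto (fun i => geod (a i) (b i) t) l (𝓝 (geod a₀ b₀ t)) := by
  have hL : 0 < dist a₀ b₀ := ht.1.trans_lt ht.2
  have hab : Tendsto (fun i => dist (a i) (b i)) l (𝓝 (dist a₀ b₀)) := ha.dist hb
  have hev : ∀ᶠ i in l, t < dist (a i) (b i) := hab.eventually (lt_mem_nhds ht.2)
  rw [tendsto_iff_dist_tendsto_zero]
  have hsq : Tendsto (fun i => dist (geod (a i) (b i) t) (geod a₀ b₀ t) ^ 2) l (𝓝 0) := by
    have hA : Tendsto (fun i => dist (a i) a₀) l (𝓝 0) := tendsto_iff_dist_tendsto_zero.1 ha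
    have hB : Tendsto (fun i => dist (b i) b₀) l (𝓝 0) := tendsto_iff_dist_tendsto_zero.1 hb
    have hlim : Tendsto (fun i => ((dist a₀ b₀ - t) * (t + dist (a i) a₀) ^ 2 +
        t * (dist (a i) (b i) - t + dist (b i) b₀) ^ 2 -
        dist a₀ b₀ * (t * (dist a₀ b₀ - t))) / dist a₀ b₀) l (𝓝 0) := by
      have := ((((hA.const_add t).pow 2).const_mul (dist a₀ b₀ - t)).add
        ((((hab.sub_const t).add hB).pow 2).const_mul t)).sub_const
          (dist a₀ b₀ * (t * (dist a₀ b₀ - t)))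
      have := this.div_const (dist a₀ b₀)
      convert this using 2
      field_simp
      ring
    refine squeeze_zero' (Eventually.of_forall fun i => sq_nonneg _) ?_ hlim
    filter_upwards [hev] with i hi
    have hti : t ∈ Icc 0 (dist (a i) (b i)) := ⟨ht.1, hi.le⟩
    rw [le_div_iff₀ hL, mul_comm]
    refine (dist_geod_sq_le hX a₀ b₀ _ ⟨ht.1, ht.2.le⟩).trans ?_
    have h1 : dist (geod (a i) (b i) t) a₀ ≤ t + dist (a i) a₀ := by
      refine (dist_triangle _ (a i) _).trans ?_
      rw [dist_comm _ (a i), dist_geod_left hX hti]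
    have h2 : dist (geod (a i) (b i) t) b₀ ≤ dist (a i) (b i) - t + dist (b i) b₀ := by
      refine (dist_triangle _ (b i) _).trans ?_
      rw [dist_geod_right hX hti]
    have h3 := pow_le_pow_left₀ dist_nonneg h1 2
    have h4 := pow_le_pow_left₀ dist_nonneg h2 2
    have h5 := mul_le_mul_of_nonneg_left h3 (sub_nonneg.2 ht.2.le)
    have h6 := mul_le_mul_of_nonneg_left h4 ht.1
    linarith
  have := hsq.sqrt
  simpa [Real.sqrt_sq dist_nonneg] using this

end CAT0Spaces

/-! ### Initial velocities of geodesics -/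

section Direction

variable {X E : Type*} [MetricSpace X] [NormedAddCommGroup E]

/-- A map from a metric space onto a closed subset of an inner product space under which the
distance dominates the length of the chord, and exceeds it at most by a cubic term when the chord is
short. -/
structure IsArcChordEmbedding (ι : X → E) (s₀ C : ℝ) : Prop where
  pos : 0 < s₀
  nonneg : 0 ≤ C
  norm_le : ∀ u v, ‖ι u - ι v‖ ≤ dist u v
  dist_le : ∀ u v, ‖ι u - ι v‖ ≤ s₀ → dist u v ≤ ‖ι u - ι v‖ + C * ‖ι u - ι v‖ ^ 3
  isClosed_range : IsClosed (range ι)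

variable {ι : X → E} {s₀ C : ℝ}

namespace IsArcChordEmbedding

theorem continuous (hι : IsArcChordEmbedding ι s₀ C) : Continuous ι :=
  LipschitzWith.continuous (K := 1) <| LipschitzWith.of_dist_le_mul fun u v => by
    simpa [dist_eq_norm] using hι.norm_le u v

theorem dist_le_mul (hι : IsArcChordEmbedding ι s₀ C) (u v : X) (h : ‖ι u - ι v‖ ≤ s₀) :
    dist u v ≤ (1 + C * s₀ ^ 2) * ‖ι u - ι v‖ := by
  refine (hι.dist_le u v h).trans ?_
  have h1 : ‖ι u - ι v‖ ^ 2 ≤ s₀ ^ 2 := pow_le_pow_left₀ (norm_nonneg _) h 2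
  have := mul_le_mul_of_nonneg_left h1 (mul_nonneg hι.nonneg (norm_nonneg (ι u - ι v)))
  nlinarith

theorem tendsto_iff (hι : IsArcChordEmbedding ι s₀ C) {T : Type*} {l : Filter T} {f : T → X}
    {x : X} : Tendsto f l (𝓝 x) ↔ Tendsto (fun t => ι (f t)) l (𝓝 (ι x)) := by
  refine ⟨fun h => (hι.continuous.tendsto x).comp h, fun h => ?_⟩
  rw [tendsto_iff_dist_tendsto_zero]
  have h0 : Tendsto (fun t => ‖ι (f t) - ι x‖) l (𝓝 0) := tendsto_iff_norm_sub_tendsto_zero.1 h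
  have h1 : Tendsto (fun t => (1 + C * s₀ ^ 2) * ‖ι (f t) - ι x‖) l (𝓝 0) := by
    simpa using h0.const_mul (1 + C * s₀ ^ 2)
  refine squeeze_zero' (Eventually.of_forall fun _ => dist_nonneg) ?_ h1
  filter_upwards [h0.eventually (ge_mem_nhds hι.pos)] with t ht
  exact hι.dist_le_mul _ _ ht

theorem sq_sub_le_norm_sq (hι : IsArcChordEmbedding ι s₀ C) {u v : X} (h : dist u v ≤ s₀) :
    dist u v ^ 2 - 2 * C * dist u v ^ 4 ≤ ‖ι u - ι v‖ ^ 2 := by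
  have h1 := hι.norm_le u v
  have h2 := hι.dist_le u v (h1.trans h)
  have h3 : ‖ι u - ι v‖ ^ 3 ≤ dist u v ^ 3 := pow_le_pow_left₀ (norm_nonneg _) h1 3
  have h4 := mul_le_mul_of_nonneg_left h3 hι.nonneg
  have h5 : 0 ≤ C * dist u v ^ 3 := mul_nonneg hι.nonneg (pow_nonneg dist_nonneg 3)
  have h6 : dist u v - ‖ι u - ι v‖ ≤ C * dist u v ^ 3 := by linarith
  have h7 := mul_le_mul_of_nonneg_right h6
    (add_nonneg (dist_nonneg (x := u) (y := v)) (norm_nonneg (ι u - ι v)))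
  have h8 := mul_le_mul_of_nonneg_left h1 h5
  nlinarith

end IsArcChordEmbedding

variable [InnerProductSpace ℝ E]

/-- The mean velocity over the time interval `[0, t]` of the geodesic from `a` to `b`. -/
noncomputable def meanVelocity (ι : X → E) (a b : X) (t : ℝ) : E :=
  t⁻¹ • (ι (geod a b t) - ι a)

/-- The initial velocity of the geodesic from `a` to `b`. -/
noncomputable def initialVelocity (ι : X → E) (a b : X) : E :=
  @lim E _ ⟨0⟩ (map (meanVelocity ι a b) (𝓝[>] 0))

variable (hX : IsCAT0Space X) (hι : IsArcChordEmbedding ι s₀ C)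
include hX hι

/-- Mean velocities over comparable times are close to each other, since the point of the geodesic
at time `s` is almost on the chord of the geodesic over `[0, t]`. -/
theorem norm_meanVelocity_sub_le_of_half_le {a b : X} {s t : ℝ} (ht : 0 < t) (hts : t ≤ s₀)
    (htL : t ≤ dist a b) (hs : t / 2 ≤ s) (hst : s ≤ t) :
    ‖meanVelocity ι a b s - meanVelocity ι a b t‖ ≤ √(2 * C) * t := by
  have hs0 : 0 < s := by linarith
  have htm : t ∈ Icc 0 (dist a b) := ⟨ht.le, htL⟩
  have hsm : s ∈ Icc 0 (dist a b) := ⟨hs0.le, hst.trans htL⟩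
  set p := ι a
  set q := ι (geod a b s) with hq
  set w := ι (geod a b t) with hw
  have h1 : ‖q - p‖ ≤ s := by
    have := hι.norm_le (geod a b s) a
    rwa [dist_comm, dist_geod_left hX hsm] at this
  have h2 : ‖w - q‖ ≤ t - s := by
    have := hι.norm_le (geod a b t) (geod a b s)
    rwa [dist_geod_geod hX htm hsm, abs_of_nonneg (by linarith)] at this
  have h3 : t ^ 2 - 2 * C * t ^ 4 ≤ ‖w - p‖ ^ 2 := by
    have hd : dist (geod a b t) a = t := by rw [dist_comm, dist_geod_left hX htm]
    have := hι.sq_sub_le_norm_sq (u := geod a b t) (v := a) (by rw [hd]; exact hts)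
    rwa [hd] at this
  have hid : ‖(t - s) • (q - p) - s • (w - q)‖ ^ 2 =
      t * ((t - s) * ‖q - p‖ ^ 2 + s * ‖w - q‖ ^ 2) - s * (t - s) * ‖w - p‖ ^ 2 := by
    have hwp : w - p = (q - p) + (w - q) := by abel
    rw [hwp, norm_sub_sq_real, norm_add_sq_real, norm_smul, norm_smul, real_inner_smul_left,
      real_inner_smul_right, mul_pow, mul_pow, Real.norm_eq_abs, Real.norm_eq_abs, sq_abs, sq_abs]
    ring
  have h4 : ‖(t - s) • (q - p) - s • (w - q)‖ ^ 2 ≤ s * (t - s) * (2 * C * t ^ 4) := by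
    have e1 := pow_le_pow_left₀ (norm_nonneg _) h1 2
    have e2 := pow_le_pow_left₀ (norm_nonneg _) h2 2
    have e3 := mul_le_mul_of_nonneg_left e1 (mul_nonneg ht.le (sub_nonneg.2 hst))
    have e4 := mul_le_mul_of_nonneg_left e2 (mul_nonneg ht.le hs0.le)
    have e5 := mul_le_mul_of_nonneg_left h3 (mul_nonneg hs0.le (sub_nonneg.2 hst))
    rw [hid]
    nlinarith
  have h5 : ‖(t - s) • (q - p) - s • (w - q)‖ ≤ s * t * (√(2 * C) * t) := by
    refine abs_le_of_sq_le_sq' (h4.trans ?_) (by positivity) |>.2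
    have hC : √(2 * C) ^ 2 = 2 * C := Real.sq_sqrt (by have := hι.nonneg; linarith)
    rw [show (s * t * (√(2 * C) * t)) ^ 2 = s * s * t ^ 4 * √(2 * C) ^ 2 by ring, hC]
    have : s * (t - s) ≤ s * s := mul_le_mul_of_nonneg_left (by linarith) hs0.le
    have := mul_le_mul_of_nonneg_right this
      (mul_nonneg (mul_nonneg zero_le_two hι.nonneg) (pow_nonneg ht.le 4))
    linarith
  have h6 : meanVelocity ι a b s - meanVelocity ι a b t =
      (s * t)⁻¹ • ((t - s) • (q - p) - s • (w - q)) := by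
    have hwp : w - p = (q - p) + (w - q) := by abel
    simp only [meanVelocity]
    change s⁻¹ • (q - p) - t⁻¹ • (w - p) = _
    rw [hwp]
    generalize q - p = x
    generalize w - q = y
    match_scalars <;> field_simp
  rw [h6, norm_smul, norm_inv, Real.norm_of_nonneg (by positivity),
    inv_mul_le_iff₀ (by positivity)]
  exact h5

/-- Mean velocities over arbitrary short times, by summing over a halving sequence of times. -/
theorem norm_meanVelocity_sub_le {a b : X} {s t : ℝ} (hts : t ≤ s₀)
    (htL : t ≤ dist a b) (hs : 0 < s) (hst : s ≤ t) :
    ‖meanVelocity ι a b s - meanVelocity ι a b t‖ ≤ 2 * √(2 * C) * t := by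
  have key : ∀ n : ℕ, ∀ t : ℝ, t ≤ s₀ → t ≤ dist a b → s ≤ t → t ≤ 2 ^ n * s →
      ‖meanVelocity ι a b s - meanVelocity ι a b t‖ ≤ 2 * √(2 * C) * t := by
    intro n
    induction n with
    | zero =>
      intro t _ _ h1 h2
      have : t = s := le_antisymm (by simpa using h2) h1
      subst this
      simp only [sub_self, norm_zero]
      positivity
    | succ n ih =>
      intro t h1 h2 h3 h4
      have ht : 0 < t := hs.trans_le h3
      have hA := Real.sqrt_nonneg (2 * C)
      rcases le_total (t / 2) s with h | h
      · refine (norm_meanVelocity_sub_le_of_half_le hX hι ht h1 h2 h h3).trans ?_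
        nlinarith [mul_nonneg hA ht.le]
      · have e1 := ih (t / 2) (by linarith) (by linarith) h (by rw [pow_succ] at h4; linarith)
        have e2 := norm_meanVelocity_sub_le_of_half_le hX hι ht h1 h2 le_rfl (by linarith)
        have e3 := norm_sub_le_norm_sub_add_norm_sub (meanVelocity ι a b s)
          (meanVelocity ι a b (t / 2)) (meanVelocity ι a b t)
        linarith
  obtain ⟨n, hn⟩ := pow_unbounded_of_one_lt (t / s) one_lt_two
  exact key n t hts htL hst ((div_lt_iff₀ hs).1 hn).le

variable [CompleteSpace E]

theorem tendsto_meanVelocity {a b : X} (hab : a ≠ b) :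
    Tendsto (meanVelocity ι a b) (𝓝[>] 0) (𝓝 (initialVelocity ι a b)) := by
  have hC : Cauchy (map (meanVelocity ι a b) (𝓝[>] 0)) := by
    rw [Metric.cauchy_iff]
    refine ⟨inferInstance, fun ε hε => ?_⟩
    set A := √(2 * C) with hA
    have hA0 : 0 ≤ A := Real.sqrt_nonneg _
    set t := min (min s₀ (dist a b)) (ε / (5 * (A + 1))) with ht
    have htpos : 0 < t := lt_min (lt_min hι.pos (dist_pos.2 hab)) (by positivity)
    have ht1 : t ≤ s₀ := (min_le_left _ _).trans (min_le_left _ _)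
    have ht2 : t ≤ dist a b := (min_le_left _ _).trans (min_le_right _ _)
    have ht3 : t * (5 * (A + 1)) ≤ ε := (le_div_iff₀ (by positivity)).1 (min_le_right _ _)
    refine ⟨_, image_mem_map (Ioc_mem_nhdsGT htpos), ?_⟩
    rintro _ ⟨s, hs, rfl⟩ _ ⟨s', hs', rfl⟩
    have e1 := norm_meanVelocity_sub_le hX hι ht1 ht2 hs.1 hs.2
    have e2 := norm_meanVelocity_sub_le hX hι ht1 ht2 hs'.1 hs'.2
    rw [dist_eq_norm]
    have e3 := norm_sub_le_norm_sub_add_norm_sub (meanVelocity ι a b s)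
          (meanVelocity ι a b t) (meanVelocity ι a b s')
    rw [norm_sub_rev (meanVelocity ι a b t)] at e3
    nlinarith [mul_nonneg hA0 htpos.le]
  exact hC.le_nhds_lim

theorem norm_meanVelocity_sub_initialVelocity_le {a b : X} {t : ℝ} (ht : 0 < t)
    (hts : t ≤ s₀) (htL : t ≤ dist a b) :
    ‖meanVelocity ι a b t - initialVelocity ι a b‖ ≤ 2 * √(2 * C) * t := by
  have hab : a ≠ b := dist_pos.1 (ht.trans_le htL)
  rw [norm_sub_rev]
  have h1 := ((tendsto_meanVelocity hX hι hab).sub_const (meanVelocity ι a b t)).norm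
  refine le_of_tendsto h1 ?_
  filter_upwards [Ioc_mem_nhdsGT ht] with s hs
  exact norm_meanVelocity_sub_le hX hι hts htL hs.1 hs.2

/-- A geodesic leaves its tangent only quadratically. -/
theorem norm_geod_sub_le {a b : X} {t : ℝ} (ht : 0 ≤ t) (hts : t ≤ s₀) (htL : t ≤ dist a b) :
    ‖ι (geod a b t) - ι a - t • initialVelocity ι a b‖ ≤ 2 * √(2 * C) * t ^ 2 := by
  rcases eq_or_lt_of_le ht with rfl | ht
  · simp [geod_zero hX]
  have h := norm_meanVelocity_sub_initialVelocity_le hX hι ht hts htL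
  have h1 : ι (geod a b t) - ι a - t • initialVelocity ι a b =
      t • (meanVelocity ι a b t - initialVelocity ι a b) := by
    rw [smul_sub, meanVelocity, smul_smul, mul_inv_cancel₀ ht.ne', one_smul]
  rw [h1, norm_smul, Real.norm_of_nonneg ht.le]
  nlinarith

theorem norm_initialVelocity {a b : X} (hab : a ≠ b) : ‖initialVelocity ι a b‖ = 1 := by
  have hsq := ((tendsto_meanVelocity hX hι hab).norm.pow 2)
  have hL : 0 < dist a b := dist_pos.2 hab
  have key : ∀ᶠ t in 𝓝[>] (0 : ℝ), 1 - 2 * C * t ^ 2 ≤ ‖meanVelocity ι a b t‖ ^ 2 ∧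
      ‖meanVelocity ι a b t‖ ^ 2 ≤ 1 := by
    filter_upwards [Ioc_mem_nhdsGT (lt_min hι.pos hL)] with t ht
    have ht0 : 0 < t := ht.1
    have ht1 : t ≤ s₀ := ht.2.trans (min_le_left _ _)
    have hd : dist (geod a b t) a = t := by
      rw [dist_comm, dist_geod_left hX ⟨ht.1.le, ht.2.trans (min_le_right _ _)⟩]
    have e1 := hι.sq_sub_le_norm_sq (u := geod a b t) (v := a) (by rw [hd]; exact ht1)
    have e2 := pow_le_pow_left₀ (norm_nonneg _) (hι.norm_le (geod a b t) a) 2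
    rw [hd] at e1 e2
    rw [meanVelocity, norm_smul, norm_inv, Real.norm_of_nonneg ht0.le, mul_pow, inv_pow]
    have ht2 : 0 < t ^ 2 := by positivity
    constructor
    · rw [← mul_le_mul_iff_right₀ ht2, ← mul_assoc, mul_inv_cancel₀ ht2.ne', one_mul]
      nlinarith
    · rw [inv_mul_le_iff₀ ht2]
      linarith
  have hlim : Tendsto (fun t : ℝ => 1 - 2 * C * t ^ 2) (𝓝[>] 0) (𝓝 1) := by
    have : Continuous fun t : ℝ => 1 - 2 * C * t ^ 2 := by fun_prop
    simpa using (this.tendsto 0).mono_left nhdsWithin_le_nhds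
  have h1 : ‖initialVelocity ι a b‖ ^ 2 = 1 :=
    le_antisymm (le_of_tendsto hsq (key.mono fun _ h => h.2))
      (le_of_tendsto_of_tendsto hlim hsq (key.mono fun _ h => h.1))
  exact (pow_eq_one_iff_of_nonneg (norm_nonneg _) two_ne_zero).1 h1

/-- The initial velocity of a geodesic depends continuously on the end points, since the mean
velocities do, and approximate it uniformly. -/
theorem tendsto_initialVelocity {T : Type*} {l : Filter T} {a b : T → X} {a₀ b₀ : X}
    (ha : Tendsto a l (𝓝 a₀)) (hb : Tendsto b l (𝓝 b₀)) (hab : a₀ ≠ b₀) :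
    Tendsto (fun i => initialVelocity ι (a i) (b i)) l (𝓝 (initialVelocity ι a₀ b₀)) := by
  rw [Metric.tendsto_nhds]
  intro ε hε
  have hL : 0 < dist a₀ b₀ := dist_pos.2 hab
  set A := √(2 * C) with hA
  have hA0 : 0 ≤ A := Real.sqrt_nonneg _
  set t := min (min s₀ (dist a₀ b₀ / 2)) (ε / (8 * (A + 1))) with ht
  have htpos : 0 < t := lt_min (lt_min hι.pos (by linarith)) (by positivity)
  have ht1 : t ≤ s₀ := (min_le_left _ _).trans (min_le_left _ _)
  have ht2 : t ≤ dist a₀ b₀ / 2 := (min_le_left _ _).trans (min_le_right _ _)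
  have ht3 : t * (8 * (A + 1)) ≤ ε := (le_div_iff₀ (by positivity)).1 (min_le_right _ _)
  have htL : t < dist a₀ b₀ := by linarith
  have hmv : Tendsto (fun i => meanVelocity ι (a i) (b i) t) l (𝓝 (meanVelocity ι a₀ b₀ t)) := by
    unfold meanVelocity
    exact (((hι.continuous.tendsto _).comp (tendsto_geod hX ha hb ⟨htpos.le, htL⟩)).sub
      ((hι.continuous.tendsto _).comp ha)).const_smul _
  filter_upwards [(ha.dist hb).eventually (lt_mem_nhds htL),
    Metric.tendsto_nhds.1 hmv (ε / 2) (by linarith)] with i hi hi2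
  have e1 := norm_meanVelocity_sub_initialVelocity_le hX hι htpos ht1 hi.le
  have e2 := norm_meanVelocity_sub_initialVelocity_le hX hι htpos ht1 htL.le
  rw [dist_eq_norm] at hi2 ⊢
  have e3 := norm_sub_le_norm_sub_add_norm_sub (initialVelocity ι (a i) (b i))
    (meanVelocity ι (a i) (b i) t) (initialVelocity ι a₀ b₀)
  have e4 := norm_sub_le_norm_sub_add_norm_sub (meanVelocity ι (a i) (b i) t)
    (meanVelocity ι a₀ b₀ t) (initialVelocity ι a₀ b₀)
  rw [norm_sub_rev _ (meanVelocity ι (a i) (b i) t)] at e3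
  nlinarith [mul_nonneg hA0 htpos.le]

end Direction

/-! ### Pursuit of a moving target in a `CAT(0)` space -/

section Pursuit

variable {X E : Type*} [MetricSpace X] [NormedAddCommGroup E] [InnerProductSpace ℝ E]

/-- At time `t` the path `u` moves with unit speed along the geodesic towards `y`: its right
derivative is the initial velocity of this geodesic. -/
def Pursues (ι : X → E) (u : ℝ → X) (y : X) (t : ℝ) : Prop :=
  HasDerivWithinAt (fun s => ι (u s)) (initialVelocity ι (u t) y) (Ici t) t

theorem Pursues.congr {ι : X → E} {u v : ℝ → X} {y : X} {t : ℝ} (h : Pursues ι u y t)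
    (huv : v =ᶠ[𝓝[≥] t] u) : Pursues ι v y t := by
  have ht : v t = u t := huv.self_of_nhdsWithin self_mem_Ici
  unfold Pursues at h ⊢
  rw [ht]
  exact h.congr_of_eventuallyEq (huv.fun_comp ι) (congrArg ι ht)

/-- Bounded families of points of `X` converge along every ultrafilter. -/
theorem IsArcChordEmbedding.exists_tendsto {X E : Type*} [MetricSpace X] [NormedAddCommGroup E]
    [ProperSpace E] {ι : X → E} {s₀ C : ℝ} (hι : IsArcChordEmbedding ι s₀ C) {T : Type*}
    (l : Ultrafilter T) {p : T → X} {x : X} {R : ℝ} (h : ∀ᶠ n in l, dist (p n) x ≤ R) :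
    ∃ z, Tendsto p l (𝓝 z) := by
  have h1 : ∀ᶠ n in l, ι (p n) ∈ Metric.closedBall (ι x) R := by
    filter_upwards [h] with n hn
    rw [Metric.mem_closedBall, dist_eq_norm]
    exact (hι.norm_le _ _).trans hn
  obtain ⟨e, -, he⟩ := (isCompact_closedBall (ι x) R).ultrafilter_le_nhds
    (l.map fun n => ι (p n)) (le_principal_iff.2 h1)
  have he' : Tendsto (fun n => ι (p n)) l (𝓝 e) := he
  obtain ⟨z, rfl⟩ := hι.isClosed_range.mem_of_tendsto he' (Eventually.of_forall fun n => ⟨_, rfl⟩)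
  exact ⟨z, hι.tendsto_iff.2 he'⟩

theorem hasDerivWithinAt_Ici_of_norm_sub_le {F : Type*} [NormedAddCommGroup F] [NormedSpace ℝ F]
    {f : ℝ → F} {v : F} {t : ℝ}
    (h : ∀ ε > 0, ∃ η > 0, ∀ s ∈ Ico t (t + η), ‖f s - f t - (s - t) • v‖ ≤ ε * (s - t)) :
    HasDerivWithinAt f v (Ici t) t := by
  rw [hasDerivWithinAt_iff_isLittleO, Asymptotics.isLittleO_iff]
  intro ε hε
  obtain ⟨η, hη, hs⟩ := h ε hε
  filter_upwards [Ico_mem_nhdsGE (show t < t + η by linarith)] with s hs'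
  rw [Real.norm_of_nonneg (sub_nonneg.2 hs'.1)]
  exact hs s hs'

variable {ι : X → E} {s₀ C : ℝ} (hX : IsCAT0Space X) (hι : IsArcChordEmbedding ι s₀ C)
include hX hι

variable [CompleteSpace E]

/-- A point that moves along a geodesic pursues the end point of this geodesic. -/
theorem pursues_geod {a b : X} {r s : ℝ} (hrs : r ≤ s) (hne : geod a b (s - r) ≠ b) :
    Pursues ι (fun t => geod a b (t - r)) b s := by
  have hlt : s - r < dist a b := by
    by_contra hc
    exact hne (geod_of_dist_le hX a b (not_lt.1 hc))
  refine hasDerivWithinAt_Ici_of_norm_sub_le fun ε hε => ?_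
  set A := √(2 * C) with hA
  have hA0 : 0 ≤ A := Real.sqrt_nonneg _
  refine ⟨min (min s₀ (dist a b - (s - r))) (ε / (2 * (A + 1))),
    lt_min (lt_min hι.pos (by linarith)) (by positivity), fun t ht => ?_⟩
  have h0 : 0 ≤ t - s := sub_nonneg.2 ht.1
  have ht2 : t - s < min (min s₀ (dist a b - (s - r))) (ε / (2 * (A + 1))) := by
    linarith [ht.2]
  rw [lt_min_iff, lt_min_iff, lt_div_iff₀ (by positivity)] at ht2
  have hg := geod_geod hX (a := a) (b := b) (s := s - r) (t := t - s) (by linarith) h0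
    (by linarith)
  have hd := dist_geod_right hX (a := a) (b := b) (t := s - r) ⟨by linarith, hlt.le⟩
  have key := norm_geod_sub_le hX hι (a := geod a b (s - r)) (b := b) h0 ht2.1.1.le
    (by rw [hd]; exact ht2.1.2.le)
  rw [hg, show s - r + (t - s) = t - r by ring] at key
  refine key.trans ?_
  nlinarith [mul_nonneg hA0 h0]

theorem Pursues.eventually_dist_geod_le {u : ℝ → X} {y : X} {t : ℝ} (h : Pursues ι u y t)
    (hne : u t ≠ y) {ε : ℝ} (hε : 0 < ε) :
    ∀ᶠ s in 𝓝[>] t, dist (u s) (geod (u t) y (s - t)) ≤ ε * (s - t) := by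
  have hg : Pursues ι (fun s => geod (u t) y (s - t)) y t :=
    pursues_geod hX hι le_rfl (by rwa [sub_self, geod_zero hX])
  unfold Pursues at h hg
  change HasDerivWithinAt (fun s => ι (geod (u t) y (s - t)))
    (initialVelocity ι (geod (u t) y (t - t)) y) (Ici t) t at hg
  rw [show geod (u t) y (t - t) = u t by rw [sub_self, geod_zero hX]] at hg
  have hd := h.sub hg
  rw [sub_self, hasDerivWithinAt_iff_isLittleO] at hd
  simp only [sub_self, geod_zero hX, smul_zero, sub_zero, Pi.sub_apply] at hd
  set M := 1 + C * s₀ ^ 2 with hM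
  have hM0 : 0 < M := by have := hι.nonneg; positivity
  have h1 := (Asymptotics.isLittleO_iff.1 hd) (div_pos hε hM0)
  have h2 := (Asymptotics.isLittleO_iff.1 hd) (zero_lt_one)
  have h3 := nhdsWithin_mono t Ioi_subset_Ici_self h1
  have h4 := nhdsWithin_mono t Ioi_subset_Ici_self h2
  have h5 : ∀ᶠ s in 𝓝[>] t, s ∈ Ioo t (t + s₀) := Ioo_mem_nhdsGT (by linarith [hι.pos])
  filter_upwards [h3, h4, h5] with s e1 e2 e3
  rw [Real.norm_of_nonneg (by linarith [e3.1])] at e1 e2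
  refine (hι.dist_le_mul _ _ (e2.trans (by linarith [e3.2]))).trans ?_
  rw [← hM]
  calc M * _ ≤ M * (ε / M * (s - t)) := mul_le_mul_of_nonneg_left e1 hM0.le
    _ = ε * (s - t) := by field_simp

/-- Two paths that pursue the same target do not move apart. -/
theorem dist_le_of_pursues {u v w : ℝ → X} {a b : ℝ} (hab : a ≤ b)
    (hu : ContinuousOn u (Icc a b)) (hv : ContinuousOn v (Icc a b))
    (huw : ∀ t ∈ Ico a b, u t ≠ w t ∧ Pursues ι u (w t) t)
    (hvw : ∀ t ∈ Ico a b, v t ≠ w t ∧ Pursues ι v (w t) t) :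
    dist (u b) (v b) ≤ dist (u a) (v a) := by
  have key := image_le_of_liminf_slope_right_le_deriv_boundary
    (f := fun t => dist (u t) (v t)) (B := fun _ => dist (u a) (v a)) (B' := fun _ => 0)
    (fun t ht => Tendsto.dist (hu t ht) (hv t ht)) le_rfl continuousOn_const
    (fun t _ => hasDerivWithinAt_const t (Ici t) _) ?_
  · exact key (right_mem_Icc.2 hab)
  intro t ht r hr
  refine Eventually.frequently ?_
  obtain ⟨hne1, hp1⟩ := huw t ht
  obtain ⟨hne2, hp2⟩ := hvw t ht
  have hpos : 0 < min (dist (u t) (w t)) (dist (v t) (w t)) :=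
    lt_min (dist_pos.2 hne1) (dist_pos.2 hne2)
  filter_upwards [hp1.eventually_dist_geod_le hX hι hne1 (show 0 < r / 3 by linarith),
    hp2.eventually_dist_geod_le hX hι hne2 (show 0 < r / 3 by linarith),
    Ioo_mem_nhdsGT (show t < t + min (dist (u t) (w t)) (dist (v t) (w t)) by linarith)]
    with s h1 h2 hs
  have hs0 : 0 < s - t := sub_pos.2 hs.1
  have hs1 : s - t < min (dist (u t) (w t)) (dist (v t) (w t)) := by linarith [hs.2]
  rw [lt_min_iff] at hs1
  have h3 := dist_geod_geod_le_dist hX (u t) (v t) (w t) hs0.le hs1.1.le hs1.2.le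
  rw [slope_def_field, div_lt_iff₀ hs0]
  have h4 := dist_triangle4 (u s) (geod (u t) (w t) (s - t)) (geod (v t) (w t) (s - t)) (v s)
  rw [dist_comm (geod (v t) (w t) (s - t)) (v s)] at h4
  nlinarith

/-- The speed of a pursuing path with respect to the metric of `X` is at most one. -/
theorem dist_le_sub_of_pursues {u w : ℝ → X} {a b : ℝ} (hab : a ≤ b)
    (hu : ContinuousOn u (Icc a b)) (huw : ∀ t ∈ Ico a b, u t ≠ w t ∧ Pursues ι u (w t) t) :
    dist (u a) (u b) ≤ b - a := by
  have key := image_le_of_liminf_slope_right_le_deriv_boundary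
    (f := fun t => dist (u a) (u t)) (B := fun t => t - a) (B' := fun _ => 1)
    (fun t ht => Tendsto.dist tendsto_const_nhds (hu t ht)) (by simp) (by fun_prop)
    (fun t _ => (hasDerivWithinAt_id t (Ici t)).sub_const a) ?_
  · exact key (right_mem_Icc.2 hab)
  intro t ht r hr
  refine Eventually.frequently ?_
  obtain ⟨hne, hp⟩ := huw t ht
  have hd : 0 < dist (u t) (w t) := dist_pos.2 hne
  filter_upwards [hp.eventually_dist_geod_le hX hι hne (show 0 < (r - 1) / 2 by linarith),
    Ioo_mem_nhdsGT (show t < t + dist (u t) (w t) by linarith)] with s h1 hs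
  have hs0 : 0 < s - t := sub_pos.2 hs.1
  have h2 := dist_geod_left hX (a := u t) (b := w t) (t := s - t) ⟨hs0.le, by linarith [hs.2]⟩
  rw [slope_def_field, div_lt_iff₀ hs0]
  have h3 := dist_triangle4 (u a) (u t) (geod (u t) (w t) (s - t)) (u s)
  rw [h2, dist_comm (geod (u t) (w t) (s - t)) (u s)] at h3
  nlinarith

/-- A path that pursues `w` stays equal to a second one that starts from the same point, as long
as the first one does not meet `w`. The second path needs to pursue `w` only while it is off `w`. -/
theorem eqOn_of_pursues {u v w : ℝ → X} {a b : ℝ}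
    (hu : ContinuousOn u (Icc a b)) (hv : ContinuousOn v (Icc a b))
    (hw : ∀ t ∈ Ico a b, ContinuousWithinAt w (Ici t) t) (hstart : u a = v a)
    (huw : ∀ t ∈ Ico a b, u t ≠ w t ∧ Pursues ι u (w t) t)
    (hvw : ∀ t ∈ Ico a b, v t ≠ w t → Pursues ι v (w t) t) : EqOn u v (Icc a b) := by
  have hcl : IsClosed ({t | u t = v t} ∩ Icc a b) := by
    have := (hu.prodMk hv).preimage_isClosed_of_isClosed isClosed_Icc isClosed_diagonal
    rw [inter_comm]
    exact this
  refine hcl.Icc_subset_of_forall_mem_nhdsWithin hstart ?_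
  rintro t ⟨heq, ht⟩
  change u t = v t at heq
  have hne : v t ≠ w t := heq ▸ (huw t ht).1
  have hcv : Tendsto v (𝓝[≥] t) (𝓝 (v t)) :=
    (hv t (Ico_subset_Icc_self ht)).mono_of_mem_nhdsWithin
      (mem_of_superset (Icc_mem_nhdsGE ht.2) (Icc_subset_Icc_left ht.1))
  have hev : ∀ᶠ s in 𝓝[≥] t, v s ≠ w s :=
    ((Tendsto.dist hcv (hw t ht)).eventually (lt_mem_nhds (dist_pos.2 hne))).mono
      fun _ h => dist_pos.1 h
  obtain ⟨c, hc, hsub⟩ := (mem_nhdsGE_iff_exists_Ico_subset' ht.2).1 hev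
  have hc' : t < min c b := lt_min hc ht.2
  filter_upwards [Ioo_mem_nhdsGT hc'] with s hs
  have hsb : s ≤ b := hs.2.le.trans (min_le_right _ _)
  have hsc : s ≤ c := hs.2.le.trans (min_le_left _ _)
  have hI : Icc t s ⊆ Icc a b := Icc_subset_Icc ht.1 hsb
  have hI' : Ico t s ⊆ Ico a b := Ico_subset_Ico ht.1 hsb
  have := dist_le_of_pursues hX hι hs.1.le (hu.mono hI) (hv.mono hI)
    (fun r hr => huw r (hI' hr)) (fun r hr =>
      ⟨hsub ⟨hr.1, hr.2.trans_le hsc⟩, hvw r (hI' hr) (hsub ⟨hr.1, hr.2.trans_le hsc⟩)⟩)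
  rw [heq, dist_self] at this
  exact dist_le_zero.1 this

/-- A pointwise limit of unit speed pursuers whose targets are close to `y` pursues `y`. -/
theorem pursues_of_tendsto {T : Type*} {l : Filter T} [l.NeBot] {u : T → ℝ → X} {v : ℝ → X}
    {y : X} {t η₀ : ℝ} (hη₀ : 0 < η₀) (hne : v t ≠ y)
    (hlim : ∀ s ∈ Ico t (t + η₀), Tendsto (fun n => u n s) l (𝓝 (v s)))
    (hLip : ∀ᶠ n in l, ∀ r ∈ Ico t (t + η₀), ∀ s ∈ Ico t (t + η₀),
      dist (u n r) (u n s) ≤ |r - s|)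
    (hpur : ∀ ε > 0, ∃ η > 0, ∀ᶠ n in l, ∀ s ∈ Ico t (t + η), ∃ y', dist y' y < ε ∧
      (u n s ≠ y' → Pursues ι (u n) y' s)) : Pursues ι v y t := by
  refine hasDerivWithinAt_Ici_of_norm_sub_le fun ε hε => ?_
  -- off the diagonal the initial velocity is continuous
  have hcont : ∀ᶠ p in 𝓝 (v t, y), p.1 ≠ p.2 ∧
      dist (initialVelocity ι p.1 p.2) (initialVelocity ι (v t) y) < ε := by
    refine Eventually.and
      ((isOpen_ne_fun continuous_fst continuous_snd).mem_nhds (x := (v t, y)) hne) ?_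
    exact (Metric.tendsto_nhds.1 (tendsto_initialVelocity hX hι
      (continuous_fst.tendsto (v t, y)) (continuous_snd.tendsto (v t, y)) hne) ε hε)
  obtain ⟨κ, hκ, hball⟩ := Metric.eventually_nhds_iff.1 hcont
  obtain ⟨η₁, hη₁, hη₁'⟩ := hpur κ hκ
  refine ⟨min (min η₀ η₁) (κ / 2), lt_min (lt_min hη₀ hη₁) (by linarith), fun s hs => ?_⟩
  have hs2 : s - t < min (min η₀ η₁) (κ / 2) := by linarith [hs.2]
  rw [lt_min_iff, lt_min_iff] at hs2
  have hst : Tendsto (fun n => ‖ι (u n s) - ι (u n t) - (s - t) • initialVelocity ι (v t) y‖) l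
      (𝓝 ‖ι (v s) - ι (v t) - (s - t) • initialVelocity ι (v t) y‖) :=
    ((((hι.continuous.tendsto _).comp (hlim s ⟨hs.1, by linarith⟩)).sub
      ((hι.continuous.tendsto _).comp (hlim t ⟨le_rfl, by linarith⟩))).sub_const _).norm
  refine le_of_tendsto hst ?_
  filter_upwards [hη₁', hLip, Metric.tendsto_nhds.1 (hlim t ⟨le_rfl, by linarith⟩) (κ / 2)
    (by linarith)] with n h1 h2 h3
  set V := initialVelocity ι (v t) y with hV
  have hmem : ∀ r ∈ Icc t s, r ∈ Ico t (t + η₀) := fun r hr => ⟨hr.1, by linarith [hr.2]⟩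
  have hderiv : ∀ r ∈ Ico t s, ∃ d : E, HasDerivWithinAt (fun s => ι (u n s)) d (Ici r) r ∧
      ‖d - V‖ ≤ ε := by
    intro r hr
    obtain ⟨y', hy', hp⟩ := h1 r ⟨hr.1, by linarith [hr.2]⟩
    have hd : dist (u n r, y') (v t, y) < κ := by
      rw [Prod.dist_eq, max_lt_iff]
      refine ⟨?_, hy'⟩
      have e1 := h2 r (hmem r ⟨hr.1, hr.2.le⟩) t (hmem t ⟨le_rfl, hs.1⟩)
      rw [abs_of_nonneg (sub_nonneg.2 hr.1)] at e1
      have e2 := dist_triangle (u n r) (u n t) (v t)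
      linarith [hr.2]
    obtain ⟨hne', hclose⟩ := hball hd
    exact ⟨_, hp hne', by rw [← dist_eq_norm]; exact hclose.le⟩
  choose! d hd1 hd2 using hderiv
  have hcontn : ContinuousOn (fun r => ι (u n r)) (Icc t s) := by
    refine hι.continuous.comp_continuousOn ?_
    refine LipschitzOnWith.continuousOn (K := 1) (LipschitzOnWith.of_dist_le_mul ?_)
    intro r hr r' hr'
    simpa [Real.dist_eq] using h2 r (hmem r hr) r' (hmem r' hr')
  have hmv := norm_image_sub_le_of_norm_deriv_right_le_segment
    (f := fun r => ι (u n r) - (r - t) • V) (f' := fun r => d r - V) (C := ε) (a := t) (b := s)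
    (hcontn.sub (by fun_prop)) ?_ hd2 s ⟨hs.1, le_rfl⟩
  · simp only [sub_self, zero_smul, sub_zero] at hmv
    rwa [sub_right_comm] at hmv
  · intro r hr
    refine (hd1 r hr).sub ?_
    simpa using! (((hasDerivWithinAt_id r (Ici r)).sub_const t).smul_const V)

/-- The Euler scheme: on consecutive time intervals of length `h` the path moves towards the
position of `w` at the end of the interval. -/
theorem exists_euler_path (w : ℝ → X) (x₀ : X) {h : ℝ} (hh : 0 < h) (k : ℕ) :
    ∃ u : ℝ → X, u 0 = x₀ ∧ (∀ s, 0 ≤ s → ∀ t, 0 ≤ t → dist (u s) (u t) ≤ |s - t|) ∧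
      ∀ s ∈ Ico 0 (k * h), ∃ s' ∈ Ioc s (s + h), u s ≠ w s' → Pursues ι u (w s') s := by
  induction k with
  | zero =>
    refine ⟨fun _ => x₀, rfl, fun s _ t _ => by simp, fun s hs => ?_⟩
    simp only [Nat.cast_zero, zero_mul, Ico_self] at hs
    exact hs.elim
  | succ k ih =>
    obtain ⟨u, hu0, huL, hup⟩ := ih
    have hkh : 0 ≤ k * h := by positivity
    set c : ℝ := k * h with hc
    set g : ℝ → X := fun t => geod (u c) (w (c + h)) (t - c) with hg
    set v : ℝ → X := fun t => if t ≤ c then u t else g t with hv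
    have hgc : g c = u c := by simp [hg, geod_zero hX]
    have hvu : ∀ t, t ≤ c → v t = u t := fun t ht => if_pos ht
    have hvg : ∀ t, c ≤ t → v t = g t := by
      intro t ht
      rcases eq_or_lt_of_le ht with rfl | ht
      · rw [hvu c le_rfl, hgc]
      · exact if_neg (not_le.2 ht)
    have hgL : ∀ s, c ≤ s → ∀ t, c ≤ t → dist (g s) (g t) ≤ |s - t| := by
      intro s hs t ht
      refine (dist_geod_geod_le hX (sub_nonneg.2 hs) (sub_nonneg.2 ht)).trans (le_of_eq ?_)
      congr 1
      ring
    have hvL : ∀ s, 0 ≤ s → ∀ t, s ≤ t → dist (v s) (v t) ≤ |s - t| := by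
      intro s hs t hst
      rcases le_total t c with h1 | h1
      · rw [hvu s (hst.trans h1), hvu t h1]
        exact huL s hs t (hs.trans hst)
      · rcases le_total s c with h2 | h2
        · rw [hvu s h2, hvg t h1]
          refine (dist_triangle _ (u c) _).trans ?_
          have e1 := huL s hs c hkh
          have e2 := hgL c le_rfl t h1
          rw [hgc] at e2
          rw [abs_of_nonpos (by linarith)] at e1 e2 ⊢
          linarith
        · rw [hvg s h2, hvg t h1]
          exact hgL s h2 t h1
    refine ⟨v, by rw [hvu 0 hkh, hu0], fun s hs t ht => ?_, fun s hs => ?_⟩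
    · rcases le_total s t with h1 | h1
      · exact hvL s hs t h1
      · rw [dist_comm, abs_sub_comm]
        exact hvL t ht s h1
    · rcases lt_or_ge s c with h1 | h1
      · obtain ⟨s', hs', hp⟩ := hup s ⟨hs.1, h1⟩
        refine ⟨s', hs', fun hne => ?_⟩
        rw [hvu s h1.le] at hne
        refine (hp hne).congr ?_
        filter_upwards [Ico_mem_nhdsGE h1] with t ht
        exact hvu t ht.2.le
      · have hs2 : s < c + h := by
          have := hs.2
          push_cast at this
          rw [hc]
          linarith
        refine ⟨c + h, ⟨hs2, by linarith⟩, fun hne => ?_⟩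
        rw [hvg s h1] at hne
        refine (pursues_geod hX hι h1 hne).congr ?_
        filter_upwards [self_mem_nhdsWithin] with t ht
        exact hvg t (h1.trans ht)

/-- Existence of a path that pursues a given right-continuous target whenever it is off the
target. -/
theorem exists_pursuit [ProperSpace E] {w : ℝ → X}
    (hw : ∀ t, 0 ≤ t → ContinuousWithinAt w (Ici t) t) (x₀ : X) :
    ∃ u : ℝ → X, u 0 = x₀ ∧ (∀ s, 0 ≤ s → ∀ t, 0 ≤ t → dist (u s) (u t) ≤ |s - t|) ∧
      ∀ t, 0 ≤ t → u t ≠ w t → Pursues ι u (w t) t := by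
  have hstep : ∀ n : ℕ, 0 < 1 / ((n : ℝ) + 1) := fun n => Nat.one_div_pos_of_nat
  choose u hu0 huL hup using fun n : ℕ =>
    exists_euler_path hX hι w x₀ (hstep n) ((n + 1) * (n + 1))
  let l : Ultrafilter ℕ := hyperfilter ℕ
  have hl : (l : Filter ℕ) ≤ atTop := by
    rw [← Nat.cofinite_eq_atTop]
    exact hyperfilter_le_cofinite
  have hex : ∀ t, 0 ≤ t → ∃ z, Tendsto (fun n => u n t) l (𝓝 z) := by
    intro t ht
    refine hι.exists_tendsto l (x := x₀) (R := t) (Eventually.of_forall fun n => ?_)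
    have := huL n t ht 0 le_rfl
    rwa [hu0, sub_zero, abs_of_nonneg ht] at this
  have : Nonempty X := ⟨x₀⟩
  choose! v hv using hex
  refine ⟨v, ?_, ?_, ?_⟩
  · refine tendsto_nhds_unique (hv 0 le_rfl) ?_
    simp only [hu0]
    exact tendsto_const_nhds
  · intro s hs t ht
    exact le_of_tendsto ((hv s hs).dist (hv t ht)) (Eventually.of_forall fun n => huL n s hs t ht)
  · intro t ht hne
    refine pursues_of_tendsto hX hι (l := (l : Filter ℕ)) (u := u) one_pos hne
      (fun s hs => hv s (ht.trans hs.1))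
      (Eventually.of_forall fun n r hr s hs => huL n r (ht.trans hr.1) s (ht.trans hs.1)) ?_
    intro ε hε
    obtain ⟨η, hη, hsub⟩ := (mem_nhdsGE_iff_exists_Ico_subset' (lt_add_one t)).1
      (Metric.tendsto_nhds.1 (hw t ht) ε hε)
    have hη' : 0 < η - t := sub_pos.2 hη
    refine ⟨(η - t) / 2, by linarith, hl ?_⟩
    have h1 : ∀ᶠ n : ℕ in atTop, 1 / ((n : ℝ) + 1) < (η - t) / 2 :=
      tendsto_one_div_add_atTop_nhds_zero_nat.eventually (gt_mem_nhds (by linarith))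
    have h2 : ∀ᶠ n : ℕ in atTop, η < n := tendsto_natCast_atTop_atTop.eventually_gt_atTop η
    filter_upwards [h1, h2] with n hn hn' s hs
    have hN : (((n + 1) * (n + 1) : ℕ) : ℝ) * (1 / ((n : ℝ) + 1)) = n + 1 := by
      push_cast
      field_simp
    obtain ⟨s', hs', hp⟩ := hup n s ⟨ht.trans hs.1, by rw [hN]; linarith [hs.2]⟩
    exact ⟨w s', hsub ⟨hs.1.trans hs'.1.le, by linarith [hs'.2, hs.2]⟩, hp⟩

/-- Stability of the pursuit: if the starting points converge to that of `u`, and the targets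
converge uniformly to that of `u`, then the pursuing paths converge to `u`, up to arbitrary
times before meeting. -/
theorem tendsto_dist_of_pursues [ProperSpace E] {T : Type*} {l : Filter T} {w u : ℝ → X} {S : ℝ}
    {w' u' : T → ℝ → X} {τ : T → ℝ}
    (hw : ∀ t ∈ Ico 0 S, ContinuousWithinAt w (Ici t) t)
    (huL : ∀ s ∈ Icc 0 S, ∀ t ∈ Icc 0 S, dist (u s) (u t) ≤ |s - t|)
    (hup : ∀ t ∈ Ico 0 S, u t ≠ w t ∧ Pursues ι u (w t) t)
    (hτ : ∀ n, τ n ∈ Icc 0 S)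
    (huL' : ∀ n, ∀ s ∈ Icc 0 (τ n), ∀ t ∈ Icc 0 (τ n), dist (u' n s) (u' n t) ≤ |s - t|)
    (hup' : ∀ n, ∀ t ∈ Ico 0 (τ n), Pursues ι (u' n) (w' n t) t)
    (hstart : Tendsto (fun n => u' n 0) l (𝓝 (u 0)))
    (htarget : ∀ ε > 0, ∀ᶠ n in l, ∀ t ∈ Ico 0 (τ n), dist (w' n t) (w t) < ε) :
    Tendsto (fun n => dist (u' n (τ n)) (u (τ n))) l (𝓝 0) := by
  rw [tendsto_iff_ultrafilter]
  intro U hU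
  obtain ⟨σ, hσ, hτσ⟩ := isCompact_Icc.ultrafilter_le_nhds (U.map τ)
    (le_principal_iff.2 (Eventually.of_forall hτ : ∀ᶠ n in U, τ n ∈ Icc 0 S))
  have hτσ : Tendsto τ U (𝓝 σ) := hτσ
  -- the paths, stopped at the times `τ n`
  set v : T → ℝ → X := fun n t => u' n (min t (τ n)) with hv
  have hmin : ∀ n t, 0 ≤ t → min t (τ n) ∈ Icc 0 (τ n) :=
    fun n t ht => ⟨le_min ht (hτ n).1, min_le_right _ _⟩
  have hvL : ∀ n, ∀ s, 0 ≤ s → ∀ t, 0 ≤ t → dist (v n s) (v n t) ≤ |s - t| := by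
    intro n s hs t ht
    refine (huL' n _ (hmin n s hs) _ (hmin n t ht)).trans ?_
    simpa using abs_min_sub_min_le_max s (τ n) t (τ n)
  have hv0 : ∀ n, v n 0 = u' n 0 := fun n => by simp [hv, (hτ n).1]
  have hstart' : Tendsto (fun n => v n 0) U (𝓝 (u 0)) := by
    simpa only [hv0] using hstart.mono_left hU
  have hex : ∀ t, 0 ≤ t → ∃ z, Tendsto (fun n => v n t) U (𝓝 z) := by
    intro t ht
    refine hι.exists_tendsto U (x := u 0) (R := t + 1) ?_
    filter_upwards [Metric.tendsto_nhds.1 hstart' 1 one_pos] with n hn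
    refine (dist_triangle _ (v n 0) _).trans ?_
    have := hvL n t ht 0 le_rfl
    rw [sub_zero, abs_of_nonneg ht] at this
    linarith
  have : Nonempty X := ⟨u 0⟩
  choose! z hz using hex
  have hzL : ∀ s, 0 ≤ s → ∀ t, 0 ≤ t → dist (z s) (z t) ≤ |s - t| := fun s hs t ht =>
    le_of_tendsto ((hz s hs).dist (hz t ht)) (Eventually.of_forall fun n => hvL n s hs t ht)
  have hcont : ∀ {f : ℝ → X} {b : ℝ},
      (∀ s ∈ Icc 0 b, ∀ t ∈ Icc 0 b, dist (f s) (f t) ≤ |s - t|) → ContinuousOn f (Icc 0 b) := by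
    intro f b hf
    refine LipschitzOnWith.continuousOn (K := 1) (LipschitzOnWith.of_dist_le_mul ?_)
    intro r hr r' hr'
    simpa [Real.dist_eq] using hf r hr r' hr'
  have hsub : Ico 0 σ ⊆ Ico 0 S := Ico_subset_Ico_right hσ.2
  have heq : EqOn u z (Icc 0 σ) := by
    refine eqOn_of_pursues hX hι (w := w) ((hcont huL).mono (Icc_subset_Icc_right hσ.2))
      (hcont fun s hs t ht => hzL s hs.1 t ht.1) (fun t ht => hw t (hsub ht)) ?_
      (fun t ht => hup t (hsub ht)) ?_
    · exact tendsto_nhds_unique hstart' (hz 0 le_rfl)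
    · intro t ht hne
      refine pursues_of_tendsto hX hι (l := (U : Filter T)) (u := v) one_pos hne
        (fun s hs => hz s (ht.1.trans hs.1))
        (Eventually.of_forall fun n r hr s hs => hvL n r (ht.1.trans hr.1) s (ht.1.trans hs.1)) ?_
      intro ε hε
      obtain ⟨c, hc, hcsub⟩ := (mem_nhdsGE_iff_exists_Ico_subset' ht.2).1
        (Metric.tendsto_nhds.1 (hw t (hsub ht)) (ε / 2) (by linarith))
      have hm : t < (t + min c σ) / 2 := by
        have : t < min c σ := lt_min hc ht.2
        linarith
      have hm1 : (t + min c σ) / 2 < c := by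
        have : min c σ ≤ c := min_le_left _ _
        linarith [show t < c from hc]
      have hm2 : (t + min c σ) / 2 < σ := by
        have : min c σ ≤ σ := min_le_right _ _
        linarith [ht.2]
      refine ⟨(t + min c σ) / 2 - t, by linarith, ?_⟩
      filter_upwards [hτσ.eventually (lt_mem_nhds hm2), hU (htarget (ε / 2) (by linarith))]
        with n hn1 hn2 s hs
      have hs2 : s < (t + min c σ) / 2 := by linarith [hs.2]
      have hs0 : 0 ≤ s := ht.1.trans hs.1
      have hsτ : s ∈ Ico 0 (τ n) := ⟨hs0, hs2.trans hn1⟩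
      refine ⟨w' n s, ?_, fun _ => (hup' n s hsτ).congr ?_⟩
      · have e1 := hn2 s hsτ
        have e2 : dist (w s) (w t) < ε / 2 := hcsub ⟨hs.1, by linarith⟩
        linarith [dist_triangle (w' n s) (w s) (w t)]
      · filter_upwards [Ico_mem_nhdsGE hsτ.2] with r hr
        simp only [hv]
        rw [min_eq_left hr.2.le]
  have e1 : Tendsto (fun n => dist (v n (τ n)) (v n σ)) U (𝓝 0) := by
    refine squeeze_zero (fun _ => dist_nonneg) (fun n => hvL n _ (hτ n).1 _ hσ.1) ?_
    have := (hτσ.sub_const σ).abs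
    simpa using this
  have e2 : Tendsto (fun n => dist (v n σ) (u σ)) U (𝓝 0) := by
    rw [heq ⟨hσ.1, le_rfl⟩]
    exact tendsto_iff_dist_tendsto_zero.1 (hz σ hσ.1)
  have e3 : Tendsto (fun n => dist (u σ) (u (τ n))) U (𝓝 0) := by
    refine squeeze_zero (fun _ => dist_nonneg) (fun n => huL _ hσ _ (hτ n)) ?_
    have := (hτσ.const_sub σ).abs
    simpa using this
  have e4 := (e1.add e2).add e3
  simp only [add_zero] at e4
  refine squeeze_zero (fun _ => dist_nonneg) (fun n => ?_) e4
  have : u' n (τ n) = v n (τ n) := by simp [hv]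
  rw [this]
  exact dist_triangle4 _ _ _ _

end Pursuit

/-! ### The intrinsic distance of a domain with exterior spheres and interior cones -/

section IntrinsicDist

variable {d : ℕ} {D : Set (EuclideanSpace ℝ (Fin d))} {x y z : EuclideanSpace ℝ (Fin d)}

/-- `γ` is a smooth path in `D`, parametrized by `[0, 1]`, from `x` to `y`. -/
def IsSmoothPath (D : Set (EuclideanSpace ℝ (Fin d))) (γ : ℝ → EuclideanSpace ℝ (Fin d))
    (x y : EuclideanSpace ℝ (Fin d)) : Prop :=
  ContDiffOn ℝ ∞ γ (Icc 0 1) ∧ MapsTo γ (Icc 0 1) D ∧ γ 0 = x ∧ γ 1 = y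

theorem IsSmoothPath.intrinsicDist_le {γ : ℝ → EuclideanSpace ℝ (Fin d)}
    (h : IsSmoothPath D γ x y) : intrinsicDist D x y ≤ eVariationOn γ (Icc 0 1) :=
  iInf₂_le γ h

theorem exists_isSmoothPath_of_intrinsicDist_lt {c : ℝ≥0∞} (h : intrinsicDist D x y < c) :
    ∃ γ, IsSmoothPath D γ x y ∧ eVariationOn γ (Icc 0 1) < c := by
  obtain ⟨γ, hγ⟩ := iInf_lt_iff.1 h
  obtain ⟨h1, h2⟩ := iInf_lt_iff.1 hγ
  exact ⟨γ, h1, h2⟩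

theorem IsSmoothPath.reverse {γ : ℝ → EuclideanSpace ℝ (Fin d)} (h : IsSmoothPath D γ x y) :
    IsSmoothPath D (fun t => γ (1 - t)) y x := by
  have hm : MapsTo (fun t : ℝ => 1 - t) (Icc 0 1) (Icc 0 1) :=
    fun t ht => ⟨by linarith [ht.2], by linarith [ht.1]⟩
  refine ⟨h.1.comp (by fun_prop) hm, h.2.1.comp hm, by simpa using h.2.2.2, by simpa using h.2.2.1⟩

/-- The part of a smooth path over `[s, t]`, reparametrized by `[0, 1]`, bounds the intrinsic
distance of its end points. -/
theorem IsSmoothPath.intrinsicDist_le_eVariationOn {γ : ℝ → EuclideanSpace ℝ (Fin d)}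
    (h : IsSmoothPath D γ x y) {s t : ℝ} (hs : s ∈ Icc (0 : ℝ) 1) (ht : t ∈ Icc (0 : ℝ) 1)
    (hst : s ≤ t) :
    intrinsicDist D (γ s) (γ t) ≤ eVariationOn γ (Icc s t) := by
  have hm : MapsTo (fun r : ℝ => s + r * (t - s)) (Icc 0 1) (Icc s t) := by
    intro r hr
    have := sub_nonneg.2 hst
    exact ⟨by nlinarith [hr.1], by nlinarith [hr.2]⟩
  have hm' : MapsTo (fun r : ℝ => s + r * (t - s)) (Icc 0 1) (Icc 0 1) :=
    fun r hr => Icc_subset_Icc hs.1 ht.2 (hm hr)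
  have hp : IsSmoothPath D (fun r => γ (s + r * (t - s))) (γ s) (γ t) :=
    ⟨h.1.comp (by fun_prop) hm', h.2.1.comp hm', by simp, by simp⟩
  refine hp.intrinsicDist_le.trans (eVariationOn.comp_le_of_monotoneOn γ _ ?_ hm)
  intro a _ b _ hab
  have := sub_nonneg.2 hst
  dsimp only
  nlinarith

theorem intrinsicDist_comm (D : Set (EuclideanSpace ℝ (Fin d))) (x y : EuclideanSpace ℝ (Fin d)) :
    intrinsicDist D x y = intrinsicDist D y x := by
  have key : ∀ x y, intrinsicDist D x y ≤ intrinsicDist D y x := by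
    intro x y
    refine le_of_forall_gt fun c hc => ?_
    obtain ⟨γ, h1, h2⟩ := exists_isSmoothPath_of_intrinsicDist_lt hc
    refine (h1.reverse.intrinsicDist_le.trans ?_).trans_lt h2
    exact eVariationOn.comp_le_of_antitoneOn γ (fun t => 1 - t)
      (fun a _ b _ h => sub_le_sub_left h 1)
      (fun t ht => ⟨by linarith [ht.2], by linarith [ht.1]⟩)
  exact le_antisymm (key x y) (key y x)

theorem edist_le_intrinsicDist : edist x y ≤ intrinsicDist D x y := by
  refine le_of_forall_gt fun c hc => ?_
  obtain ⟨γ, ⟨-, -, rfl, rfl⟩, h2⟩ := exists_isSmoothPath_of_intrinsicDist_lt hc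
  exact (eVariationOn.edist_le γ (left_mem_Icc.2 zero_le_one)
    (right_mem_Icc.2 zero_le_one)).trans_lt h2

theorem intrinsicDist_le_of_segment_subset (h : segment ℝ x y ⊆ D) :
    intrinsicDist D x y ≤ edist x y := by
  have hp : IsSmoothPath D (AffineMap.lineMap x y) x y := by
    refine ⟨?_, fun t ht => h ?_, by simp, by simp⟩
    · exact ContDiff.contDiffOn (by
      rw [AffineMap.coe_lineMap]
      simp only [vsub_eq_sub, vadd_eq_add]
      fun_prop)
    · rw [segment_eq_image_lineMap]
      exact mem_image_of_mem _ ht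
  refine hp.intrinsicDist_le.trans ?_
  have := LipschitzOnWith.comp_eVariationOn_le (g := id) (s := Icc (0 : ℝ) 1)
    ((lipschitzWith_lineMap (𝕜 := ℝ) x y).lipschitzOnWith (s := univ)) (mapsTo_univ _ _)
  rw [eVariationOn_id_Icc, sub_zero, ENNReal.ofReal_one, mul_one] at this
  rwa [edist_nndist]

/-- The triangle inequality: two smooth paths are concatenated to a smooth path, after they have
been reparametrized so as to be stationary near the common end point. -/
theorem intrinsicDist_triangle (D : Set (EuclideanSpace ℝ (Fin d)))
    (x y z : EuclideanSpace ℝ (Fin d)) :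
    intrinsicDist D x z ≤ intrinsicDist D x y + intrinsicDist D y z := by
  refine ENNReal.le_of_forall_pos_le_add fun ε hε hfin => ?_
  have hε2 : ((ε / 2 : NNReal) : ℝ≥0∞) ≠ 0 := by simpa using hε.ne'
  obtain ⟨hf1, hf2⟩ := ENNReal.add_lt_top.1 hfin
  obtain ⟨γ₁, ⟨hs1, hm1, h10, h11⟩, hv1⟩ := exists_isSmoothPath_of_intrinsicDist_lt
    (ENNReal.lt_add_right hf1.ne hε2)
  obtain ⟨γ₂, ⟨hs2, hm2, h20, h21⟩, hv2⟩ := exists_isSmoothPath_of_intrinsicDist_lt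
    (ENNReal.lt_add_right hf2.ne hε2)
  set φ₁ : ℝ → ℝ := fun t => Real.smoothTransition (3 * t) with hφ₁
  set φ₂ : ℝ → ℝ := fun t => Real.smoothTransition (3 * t - 2) with hφ₂
  have hI1 : ∀ t, φ₁ t ∈ Icc (0 : ℝ) 1 := fun t =>
    ⟨Real.smoothTransition.nonneg _, Real.smoothTransition.le_one _⟩
  have hI2 : ∀ t, φ₂ t ∈ Icc (0 : ℝ) 1 := fun t =>
    ⟨Real.smoothTransition.nonneg _, Real.smoothTransition.le_one _⟩
  have hc1 : ContDiff ℝ ∞ (fun t => γ₁ (φ₁ t)) :=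
    hs1.comp_contDiff (Real.smoothTransition.contDiff.comp (by fun_prop)) hI1
  have hc2 : ContDiff ℝ ∞ (fun t => γ₂ (φ₂ t)) :=
    hs2.comp_contDiff (Real.smoothTransition.contDiff.comp (by fun_prop)) hI2
  have hmono1 : Monotone φ₁ := fun a b hab => Real.smoothTransition.monotone (by linarith)
  have hmono2 : Monotone φ₂ := fun a b hab => Real.smoothTransition.monotone (by linarith)
  set γ : ℝ → EuclideanSpace ℝ (Fin d) := fun t => if t < 1 / 2 then γ₁ (φ₁ t) else γ₂ (φ₂ t)
    with hγ
  have heq1 : ∀ t, t < 2 / 3 → γ t = γ₁ (φ₁ t) := by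
    intro t ht
    by_cases h : t < 1 / 2
    · exact if_pos h
    · have e1 : φ₂ t = 0 := Real.smoothTransition.zero_of_nonpos (by linarith)
      have e2 : φ₁ t = 1 := Real.smoothTransition.one_of_one_le (by linarith)
      simp only [hγ, if_neg h, e1, e2, h20, h11]
  have heq2 : ∀ t, 1 / 3 < t → γ t = γ₂ (φ₂ t) := by
    intro t ht
    by_cases h : t < 1 / 2
    · have e1 : φ₂ t = 0 := Real.smoothTransition.zero_of_nonpos (by linarith)
      have e2 : φ₁ t = 1 := Real.smoothTransition.one_of_one_le (by linarith)
      simp only [hγ, if_pos h, e1, e2, h20, h11]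
    · exact if_neg h
  have hp : IsSmoothPath D γ x z := by
    refine ⟨ContDiff.contDiffOn (contDiff_iff_contDiffAt.2 fun t => ?_), fun t _ => ?_, ?_, ?_⟩
    · rcases lt_or_ge t (1 / 2) with h | h
      · refine hc1.contDiffAt.congr_of_eventuallyEq ?_
        filter_upwards [Iio_mem_nhds (show t < 2 / 3 by linarith)] with s hs using heq1 s hs
      · refine hc2.contDiffAt.congr_of_eventuallyEq ?_
        filter_upwards [Ioi_mem_nhds (show 1 / 3 < t by linarith)] with s hs using heq2 s hs
    · by_cases h : t < 1 / 2
      · rw [heq1 t (by linarith)]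
        exact hm1 (hI1 t)
      · rw [heq2 t (by linarith)]
        exact hm2 (hI2 t)
    · rw [heq1 0 (by norm_num)]
      simp [hφ₁, h10]
    · rw [heq2 1 (by norm_num)]
      have : φ₂ 1 = 1 := Real.smoothTransition.one_of_one_le (by norm_num)
      rw [this, h21]
  refine hp.intrinsicDist_le.trans ?_
  have hsplit := eVariationOn.Icc_add_Icc γ (s := univ) (a := 0) (b := 1 / 2) (c := 1)
    (by norm_num) (by norm_num) (mem_univ _)
  simp only [univ_inter] at hsplit
  rw [← hsplit]
  have hle1 : eVariationOn γ (Icc 0 (1 / 2)) ≤ eVariationOn γ₁ (Icc 0 1) := by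
    rw [eVariationOn.congr (g := γ₁ ∘ φ₁) fun t ht => heq1 t (by linarith [ht.2])]
    exact eVariationOn.comp_le_of_monotoneOn γ₁ φ₁ (hmono1.monotoneOn _) fun t _ => hI1 t
  have hle2 : eVariationOn γ (Icc (1 / 2) 1) ≤ eVariationOn γ₂ (Icc 0 1) := by
    rw [eVariationOn.congr (g := γ₂ ∘ φ₂) fun t ht => heq2 t (by linarith [ht.1])]
    exact eVariationOn.comp_le_of_monotoneOn γ₂ φ₂ (hmono2.monotoneOn _) fun t _ => hI2 t
  calc eVariationOn γ (Icc 0 (1 / 2)) + eVariationOn γ (Icc (1 / 2) 1)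
      ≤ (intrinsicDist D x y + (ε / 2 : NNReal)) + (intrinsicDist D y z + (ε / 2 : NNReal)) :=
        add_le_add (hle1.trans hv1.le) (hle2.trans hv2.le)
    _ = intrinsicDist D x y + intrinsicDist D y z + ((ε / 2 : NNReal) + (ε / 2 : NNReal)) := by
        abel
    _ = intrinsicDist D x y + intrinsicDist D y z + ε := by
        rw [← ENNReal.coe_add, add_halves]

end IntrinsicDist

section Boundary

variable {d : ℕ} {D : Set (EuclideanSpace ℝ (Fin d))}

theorem le_norm_sub_of_ball_inter_eq_empty {c u : EuclideanSpace ℝ (Fin d)} {r : ℝ}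
    (h : Metric.ball c r ∩ D = ∅) (hu : u ∈ closure D) : r ≤ ‖u - c‖ := by
  have h1 : Disjoint (Metric.ball c r) (closure D) :=
    (disjoint_iff_inter_eq_empty.2 h).closure_right Metric.isOpen_ball
  by_contra hc
  exact h1.le_bot ⟨by rw [Metric.mem_ball, dist_eq_norm]; exact not_le.1 hc, hu⟩

/-- A nearest point of the closure of `D` to the midpoint of a chord is close to this midpoint:
otherwise the exterior ball at the nearest point would contain an end point of the chord. -/
theorem UniformExteriorSphere.exists_norm_sub_midpoint_le {r : ℝ} (hD : IsOpen D)
    (hr : UniformExteriorSphere D r) {u v : EuclideanSpace ℝ (Fin d)} (hu : u ∈ closure D)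
    (hv : v ∈ closure D) (huv : ‖u - v‖ ≤ 2 * r) :
    ∃ p ∈ closure D, ‖p - midpoint ℝ u v‖ * (4 * r) ≤ ‖u - v‖ ^ 2 := by
  set m := midpoint ℝ u v with hm
  by_cases hmD : m ∈ closure D
  · exact ⟨m, hmD, by simp⟩
  obtain ⟨p, hp, hdist⟩ := isClosed_closure.exists_infDist_eq_dist ⟨u, hu⟩ m
  set s := dist m p with hs
  have hpm : p ≠ m := fun h => hmD (h ▸ hp)
  have hs0 : 0 < s := dist_pos.2 hpm.symm
  have hmin : ∀ q ∈ closure D, s ≤ dist m q := fun q hq => hdist ▸ Metric.infDist_le_dist_of_mem hq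
  have hpf : p ∈ frontier D := by
    refine ⟨hp, fun hint => ?_⟩
    rw [hD.interior_eq] at hint
    -- an interior point could be moved towards `m`
    have hcont : Tendsto (fun t : ℝ => p + t • (m - p)) (𝓝[>] 0) (𝓝 p) := by
      have : Continuous fun t : ℝ => p + t • (m - p) := by fun_prop
      simpa using (this.tendsto 0).mono_left nhdsWithin_le_nhds
    obtain ⟨t, ht1, ht2⟩ := ((hcont.eventually (hD.mem_nhds hint)).and
      (Ioo_mem_nhdsGT (zero_lt_one (α := ℝ)))).exists
    have h1 := hmin _ (subset_closure ht1)
    have h2 : dist m (p + t • (m - p)) = (1 - t) * s := by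
      rw [hs, dist_eq_norm, dist_eq_norm,
        show m - (p + t • (m - p)) = (1 - t) • (m - p) by module, norm_smul,
        Real.norm_of_nonneg (by linarith [ht2.2])]
    rw [h2] at h1
    nlinarith [ht2.1]
  have hsle : s ≤ r := by
    refine (hmin u hu).trans ?_
    rw [hm, dist_midpoint_left, dist_eq_norm, Real.norm_of_nonneg zero_le_two]
    linarith
  obtain ⟨hr0, hext⟩ := hr
  set ν : EuclideanSpace ℝ (Fin d) := s⁻¹ • (m - p) with hν
  have hsν : s • ν = m - p := by rw [hν, smul_smul, mul_inv_cancel₀ hs0.ne', one_smul]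
  have hν1 : ‖ν‖ = 1 := by
    rw [hν, norm_smul, norm_inv, Real.norm_of_nonneg hs0.le, ← dist_eq_norm, ← hs,
      inv_mul_cancel₀ hs0.ne']
  have hmem : ν ∈ exteriorNormals D p r := by
    rw [(hext p hpf).2 s hs0 hsle]
    refine ⟨hν1, ?_⟩
    rw [hsν, add_sub_cancel, ← disjoint_iff_inter_eq_empty, Set.disjoint_left]
    intro q hq hqD
    have := hmin q (subset_closure hqD)
    rw [Metric.mem_ball, dist_comm] at hq
    linarith
  have hball : ∀ q ∈ closure D, 2 * r * inner ℝ (q - p) ν ≤ ‖q - p‖ ^ 2 := by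
    intro q hq
    have h1 := le_norm_sub_of_ball_inter_eq_empty hmem.2 hq
    have h2 := pow_le_pow_left₀ hr0.le h1 2
    rw [← sub_sub, norm_sub_sq_real, real_inner_smul_right, norm_smul, hν1,
      Real.norm_of_nonneg hr0.le] at h2
    linarith
  refine ⟨p, hp, ?_⟩
  have h1 := hball u hu
  have h2 := hball v hv
  have hsum : (u - p) + (v - p) = (2 * s) • ν := by
    rw [mul_smul, hsν, hm, midpoint_eq_smul_add, invOf_eq_inv]
    module
  have h3 : inner ℝ (u - p) ν + inner ℝ (v - p) ν = 2 * s := by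
    rw [← inner_add_left, hsum, real_inner_smul_left, real_inner_self_eq_norm_sq, hν1]
    ring
  have h4 := parallelogram_law_with_norm ℝ (u - p) (v - p)
  rw [hsum, norm_smul, hν1, Real.norm_of_nonneg (by linarith), sub_sub_sub_cancel_right] at h4
  rw [← dist_eq_norm p m, dist_comm, ← hs]
  nlinarith

/-- A short chord of the closure of `D` may be replaced by two shorter chords whose total length is
only slightly larger. -/
theorem UniformExteriorSphere.exists_split {r : ℝ} (hD : IsOpen D)
    (hr : UniformExteriorSphere D r) {u v : EuclideanSpace ℝ (Fin d)} (hu : u ∈ closure D)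
    (hv : v ∈ closure D) (huv : ‖u - v‖ ≤ r / 4) :
    ∃ p ∈ closure D, ‖p - midpoint ℝ u v‖ ≤ ‖u - v‖ / 16 ∧ ‖u - p‖ ≤ 9 / 16 * ‖u - v‖ ∧
      ‖p - v‖ ≤ 9 / 16 * ‖u - v‖ ∧
      (‖u - p‖ + (r ^ 2)⁻¹ * ‖u - p‖ ^ 3) + (‖p - v‖ + (r ^ 2)⁻¹ * ‖p - v‖ ^ 3) ≤
        ‖u - v‖ + (r ^ 2)⁻¹ * ‖u - v‖ ^ 3 := by
  have hr0 := hr.1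
  obtain ⟨p, hp, hpm⟩ := hr.exists_norm_sub_midpoint_le hD hu hv (by linarith)
  set m := midpoint ℝ u v with hm
  set l := ‖u - v‖ with hl
  have hl0 : 0 ≤ l := norm_nonneg _
  set s := ‖p - m‖ with hs
  have hs0 : 0 ≤ s := norm_nonneg _
  have hs1 : s ≤ l / 16 := by
    have : s * (4 * r) ≤ l / 16 * (4 * r) := by nlinarith
    exact le_of_mul_le_mul_right this (by linarith)
  have hum : ‖u - m‖ = l / 2 := by
    rw [← dist_eq_norm, hm, dist_left_midpoint, dist_eq_norm, Real.norm_of_nonneg zero_le_two]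
    ring
  have hvm : ‖m - v‖ = l / 2 := by
    rw [← dist_eq_norm, hm, dist_midpoint_right, dist_eq_norm, Real.norm_of_nonneg zero_le_two]
    ring
  have ha : ‖u - p‖ ≤ 9 / 16 * l := by
    have := norm_sub_le_norm_sub_add_norm_sub u m p
    rw [hum, norm_sub_rev m p] at this
    linarith
  have hb : ‖p - v‖ ≤ 9 / 16 * l := by
    have := norm_sub_le_norm_sub_add_norm_sub p m v
    rw [hvm] at this
    linarith
  refine ⟨p, hp, hs1, ha, hb, ?_⟩
  set a := ‖u - p‖ with ha'
  set b := ‖p - v‖ with hb'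
  have ha0 : 0 ≤ a := norm_nonneg _
  have hb0 : 0 ≤ b := norm_nonneg _
  set q := (r ^ 2)⁻¹ with hq
  have hq0 : 0 < q := by positivity
  have hqr : q * r ^ 2 = 1 := inv_mul_cancel₀ (by positivity)
  have hpar : a ^ 2 + b ^ 2 = 2 * s ^ 2 + l ^ 2 / 2 := by
    have h4 := parallelogram_law_with_norm ℝ (u - p) (p - v)
    have e1 : (u - p) + (p - v) = u - v := by abel
    have e2 : (u - p) - (p - v) = (-2 : ℝ) • (p - m) := by
      rw [hm, midpoint_eq_smul_add, invOf_eq_inv]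
      module
    rw [e1, e2, norm_smul] at h4
    norm_num at h4
    nlinarith
  have hsq : s ^ 2 ≤ q * l ^ 4 / 16 := by
    have h1 := pow_le_pow_left₀ (by positivity) hpm 2
    have h2 := mul_le_mul_of_nonneg_left h1 hq0.le
    have h3 : q * (s * (4 * r)) ^ 2 = 16 * s ^ 2 * (q * r ^ 2) := by ring
    rw [h3, hqr] at h2
    have h4 : q * (l ^ 2) ^ 2 = q * l ^ 4 := by ring
    rw [h4] at h2
    linarith
  set X := q * l ^ 2 with hX
  have hX0 : 0 ≤ X := by positivity
  have hX1 : X ≤ 1 / 16 := by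
    have h1 := pow_le_pow_left₀ hl0 huv 2
    have h2 := mul_le_mul_of_nonneg_left h1 hq0.le
    have h3 : q * (r / 4) ^ 2 = (q * r ^ 2) / 16 := by ring
    rw [h3, hqr] at h2
    exact h2
  have hab : a + b ≤ l * (1 + X / 8) := by
    refine abs_le_of_sq_le_sq' ?_ (by positivity) |>.2
    have h1 : (a + b) ^ 2 ≤ l ^ 2 + q * l ^ 4 / 4 := by nlinarith [sq_nonneg (a - b)]
    have h2 : q * l ^ 4 = l ^ 2 * X := by rw [hX]; ring
    rw [h2] at h1
    nlinarith [mul_nonneg (sq_nonneg l) (sq_nonneg X)]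
  have hcube : ∀ c, 0 ≤ c → c ≤ 9 / 16 * l → q * c ^ 3 ≤ 81 / 256 * X * c := by
    intro c hc hcl
    have h1 := pow_le_pow_left₀ hc hcl 2
    have h2 := mul_le_mul_of_nonneg_left h1 (mul_nonneg hq0.le hc)
    rw [hX]
    nlinarith
  have hca := hcube a ha0 ha
  have hcb := hcube b hb0 hb
  have hfin : (a + b) * (1 + 81 / 256 * X) ≤ l * (1 + X) := by
    refine (mul_le_mul_of_nonneg_right hab (by positivity)).trans ?_
    rw [mul_assoc]
    refine mul_le_mul_of_nonneg_left ?_ hl0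
    nlinarith
  have hlast : l * (1 + X) = l + q * l ^ 3 := by rw [hX]; ring
  rw [hlast] at hfin
  linarith

theorem UniformInteriorCone.cos_lt_one {δ α : ℝ} (h : UniformInteriorCone D δ α) :
    Real.cos α < 1 := by
  obtain ⟨-, h0, h1, -⟩ := h
  have := Real.cos_lt_cos_of_nonneg_of_le_pi (le_refl 0) (by linarith [Real.pi_pos]) h0
  rwa [Real.cos_zero] at this

/-- A point near the closure of `D` is moved into `D` by a translation along the axis of the
interior cone. -/
theorem add_smul_mem_of_cone {δ α ε : ℝ} (hα : Real.cos α < 1) (hα0 : 0 ≤ Real.cos α)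
    {x₀ m : EuclideanSpace ℝ (Fin d)} (hm : ‖m‖ = 1)
    (hcone : ∀ y ∈ D ∩ Metric.ball x₀ δ, ∀ z : EuclideanSpace ℝ (Fin d),
      ‖z‖ * Real.cos α < inner ℝ z m → y + z ∈ Metric.ball x₀ δ → y + z ∈ D)
    (hε : 0 < ε) (hεδ : ε ≤ δ / 8) {u w : EuclideanSpace ℝ (Fin d)} (hu : u ∈ closure D)
    (hux : ‖u - x₀‖ < δ / 4) (hwu : ‖w - u‖ ≤ (1 - Real.cos α) / 8 * ε) : w + ε • m ∈ D := by
  set k := Real.cos α with hk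
  have hc : 0 < (1 - k) / 8 * ε := mul_pos (by linarith) hε
  obtain ⟨y, hyD, hy⟩ := Metric.mem_closure_iff.1 hu _ hc
  rw [dist_eq_norm] at hy
  have hkε : (1 - k) / 8 * ε ≤ ε / 8 := by nlinarith
  have hyx : ‖y - x₀‖ < δ / 2 := by
    have := norm_sub_le_norm_sub_add_norm_sub y u x₀
    rw [norm_sub_rev y u] at this
    linarith
  have hwy : ‖w - y‖ ≤ (1 - k) / 4 * ε := by
    have := norm_sub_le_norm_sub_add_norm_sub w u y
    linarith
  have hwx : ‖w - x₀‖ < δ / 2 := by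
    have := norm_sub_le_norm_sub_add_norm_sub w u x₀
    linarith
  have hεm : ‖ε • m‖ = ε := by rw [norm_smul, hm, Real.norm_of_nonneg hε.le, mul_one]
  have := hcone y ⟨hyD, by rw [Metric.mem_ball, dist_eq_norm]; linarith⟩ (w - y + ε • m) ?_ ?_
  · rwa [← add_assoc, add_sub_cancel] at this
  · have h1 : ‖w - y + ε • m‖ ≤ (1 - k) / 4 * ε + ε := by
      refine (norm_add_le _ _).trans ?_
      rw [hεm]
      linarith
    have h2 : -((1 - k) / 4 * ε) ≤ inner ℝ (w - y) m := by
      have := (abs_le.1 (abs_real_inner_le_norm (w - y) m)).1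
      rw [hm, mul_one] at this
      linarith
    rw [inner_add_left, real_inner_smul_left, real_inner_self_eq_norm_sq, hm]
    have h3 := mul_le_mul_of_nonneg_right h1 hα0
    have h4 : 0 < (1 - k) * ε := mul_pos (by linarith) hε
    nlinarith
  · rw [← add_assoc, add_sub_cancel, Metric.mem_ball, dist_eq_norm, add_sub_right_comm]
    refine (norm_add_le _ _).trans_lt ?_
    rw [hεm]
    linarith

/-- Translates into `D` of short chords of the closure of `D`, near a boundary point. A chord is
subdivided repeatedly, until the translate of the polygon by `ε • m` lies in `D`. -/
theorem intrinsicDist_add_smul_le {r δ α ε : ℝ} (hD : IsOpen D) (hr : UniformExteriorSphere D r)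
    (hα : Real.cos α < 1) (hα0 : 0 ≤ Real.cos α)
    {x₀ m : EuclideanSpace ℝ (Fin d)} (hm : ‖m‖ = 1)
    (hcone : ∀ y ∈ D ∩ Metric.ball x₀ δ, ∀ z : EuclideanSpace ℝ (Fin d),
      ‖z‖ * Real.cos α < inner ℝ z m → y + z ∈ Metric.ball x₀ δ → y + z ∈ D)
    (hε : 0 < ε) (hεδ : ε ≤ δ / 8) (n : ℕ) :
    ∀ u ∈ closure D, ∀ v ∈ closure D, ‖u - v‖ ≤ r / 4 →
      ‖midpoint ℝ u v - x₀‖ + ‖u - v‖ ≤ δ / 8 →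
      ‖u - v‖ ≤ (3 / 2 : ℝ) ^ n * ((1 - Real.cos α) / 8 * ε) →
      intrinsicDist D (u + ε • m) (v + ε • m) ≤
        ENNReal.ofReal (‖u - v‖ + (r ^ 2)⁻¹ * ‖u - v‖ ^ 3) := by
  have hhalf : ∀ u v : EuclideanSpace ℝ (Fin d), ‖u - midpoint ℝ u v‖ = ‖u - v‖ / 2 := by
    intro u v
    rw [← dist_eq_norm, dist_left_midpoint, dist_eq_norm, Real.norm_of_nonneg zero_le_two]
    ring
  induction n with
  | zero =>
    intro u hu v hv _ h2 h3
    rw [pow_zero, one_mul] at h3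
    have hux : ‖u - x₀‖ < δ / 4 := by
      have := norm_sub_le_norm_sub_add_norm_sub u (midpoint ℝ u v) x₀
      rw [hhalf] at this
      linarith [norm_nonneg (midpoint ℝ u v - x₀), norm_nonneg (u - v)]
    have hseg : segment ℝ (u + ε • m) (v + ε • m) ⊆ D := by
      intro w hw
      rw [segment_eq_image_lineMap] at hw
      obtain ⟨t, ht, rfl⟩ := hw
      have e1 : AffineMap.lineMap (u + ε • m) (v + ε • m) t = (u + t • (v - u)) + ε • m := by
        rw [AffineMap.lineMap_apply_module']
        module
      rw [e1]
      refine add_smul_mem_of_cone hα hα0 hm hcone hε hεδ hu hux ?_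
      rw [add_sub_cancel_left, norm_smul, Real.norm_of_nonneg ht.1, norm_sub_rev]
      exact (mul_le_of_le_one_left (norm_nonneg _) ht.2).trans h3
    refine (intrinsicDist_le_of_segment_subset hseg).trans ?_
    rw [edist_add_right, edist_dist, dist_eq_norm]
    refine ENNReal.ofReal_le_ofReal ?_
    have : 0 ≤ (r ^ 2)⁻¹ * ‖u - v‖ ^ 3 := by positivity
    linarith
  | succ n ih =>
    intro u hu v hv h1 h2 h3
    obtain ⟨p, hp, hpm, ha, hb, hsum⟩ := hr.exists_split hD hu hv h1
    have hpos : 0 ≤ (r ^ 2)⁻¹ := by positivity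
    have hl0 := norm_nonneg (u - v)
    have hpow : 9 / 16 * ‖u - v‖ ≤ (3 / 2 : ℝ) ^ n * ((1 - Real.cos α) / 8 * ε) := by
      rw [pow_succ] at h3
      have : 0 ≤ (3 / 2 : ℝ) ^ n * ((1 - Real.cos α) / 8 * ε) := by
        have := sub_nonneg.2 hα.le
        positivity
      nlinarith
    -- the children stay in the region where the cone condition applies
    have hmid : ∀ q : EuclideanSpace ℝ (Fin d),
        ‖q - midpoint ℝ u v‖ = ‖u - v‖ / 2 → ‖midpoint ℝ q p - x₀‖ + 9 / 16 * ‖u - v‖ ≤ δ / 8 := by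
      intro q hq
      have e1 : midpoint ℝ q p - x₀ = (midpoint ℝ u v - x₀) +
          (1 / 2 : ℝ) • ((q - midpoint ℝ u v) + (p - midpoint ℝ u v)) := by
        rw [midpoint_eq_smul_add ℝ q p, invOf_eq_inv]
        module
      have e2 : ‖midpoint ℝ q p - x₀‖ ≤ ‖midpoint ℝ u v - x₀‖ +
          1 / 2 * (‖q - midpoint ℝ u v‖ + ‖p - midpoint ℝ u v‖) := by
        rw [e1]
        refine (norm_add_le _ _).trans ?_
        rw [norm_smul, Real.norm_of_nonneg (by norm_num : (0 : ℝ) ≤ 1 / 2)]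
        have := norm_add_le (q - midpoint ℝ u v) (p - midpoint ℝ u v)
        linarith
      rw [hq] at e2
      linarith
    have hmu := hmid u (hhalf u v)
    have hmv := hmid v (by rw [midpoint_comm, hhalf, norm_sub_rev])
    have i1 := ih u hu p hp (by linarith) (by linarith) (ha.trans hpow)
    have i2 := ih p hp v hv (by linarith) (by rw [midpoint_comm]; linarith) (hb.trans hpow)
    refine (intrinsicDist_triangle D _ (p + ε • m) _).trans ((add_le_add i1 i2).trans ?_)
    rw [← ENNReal.ofReal_add (by positivity) (by positivity)]
    exact ENNReal.ofReal_le_ofReal hsum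

/-- In a domain with the exterior sphere and interior cone conditions the intrinsic distance of two
close points exceeds the length of their chord at most by a cubic term. -/
theorem exists_intrinsicDist_le {r δ α : ℝ} (hD : IsOpen D) (hr : UniformExteriorSphere D r)
    (hcone : UniformInteriorCone D δ α) :
    ∃ s₀ > 0, ∀ u ∈ D, ∀ v ∈ D, ‖u - v‖ ≤ s₀ →
      intrinsicDist D u v ≤ ENNReal.ofReal (‖u - v‖ + (r ^ 2)⁻¹ * ‖u - v‖ ^ 3) := by
  have hα1 := hcone.cos_lt_one
  obtain ⟨hδ, hα0, hα2, hc⟩ := hcone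
  have hcos : 0 ≤ Real.cos α := Real.cos_nonneg_of_neg_pi_div_two_le_of_le (by linarith) hα2
  have hr0 := hr.1
  refine ⟨min (r / 4) (δ / 32), by positivity, fun u hu v hv huv => ?_⟩
  have huv1 : ‖u - v‖ ≤ r / 4 := huv.trans (min_le_left _ _)
  have huv2 : ‖u - v‖ ≤ δ / 32 := huv.trans (min_le_right _ _)
  by_cases hnear : ∃ x₀ ∈ frontier D, ‖u - x₀‖ < δ / 16
  · obtain ⟨x₀, hx₀, hux⟩ := hnear
    obtain ⟨m, hm, hmc⟩ := hc x₀ hx₀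
    have hmid : ‖midpoint ℝ u v - x₀‖ + ‖u - v‖ ≤ δ / 8 := by
      have := norm_sub_le_norm_sub_add_norm_sub (midpoint ℝ u v) u x₀
      rw [← dist_eq_norm (midpoint ℝ u v) u, dist_midpoint_left, dist_eq_norm u v,
        Real.norm_of_nonneg zero_le_two] at this
      linarith
    have hvx : ‖v - x₀‖ < δ / 8 := by
      have := norm_sub_le_norm_sub_add_norm_sub v u x₀
      rw [norm_sub_rev v u] at this
      linarith
    have hshift : ∀ w ∈ D, ‖w - x₀‖ < δ / 8 → ∀ ε, 0 < ε → ε ≤ δ / 8 →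
        intrinsicDist D w (w + ε • m) ≤ ENNReal.ofReal ε := by
      intro w hw hwx ε hε hεδ
      have hseg : segment ℝ w (w + ε • m) ⊆ D := by
        intro q hq
        rw [segment_eq_image_lineMap] at hq
        obtain ⟨t, ht, rfl⟩ := hq
        rw [AffineMap.lineMap_apply_module', add_sub_cancel_left, smul_smul, add_comm]
        rcases eq_or_lt_of_le ht.1 with rfl | ht0
        · simpa using hw
        · refine add_smul_mem_of_cone hα1 hcos hm hmc (mul_pos ht0 hε)
            ((mul_le_of_le_one_left hε.le ht.2).trans hεδ) (subset_closure hw) (by linarith) ?_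
          rw [sub_self, norm_zero]
          exact mul_nonneg (by linarith) (by positivity)
      refine (intrinsicDist_le_of_segment_subset hseg).trans (le_of_eq ?_)
      rw [edist_dist, dist_eq_norm, sub_add_cancel_left, norm_neg, norm_smul, hm, mul_one,
        Real.norm_of_nonneg hε.le]
    refine ENNReal.le_of_forall_pos_le_add fun ε' hε' _ => ?_
    set ε := min ((ε' : ℝ) / 2) (δ / 8) with hεdef
    have hε : 0 < ε := lt_min (by positivity) (by positivity)
    have hεδ : ε ≤ δ / 8 := min_le_right _ _
    have hc0 : 0 < (1 - Real.cos α) / 8 * ε := mul_pos (by linarith) hε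
    obtain ⟨n, hn⟩ := pow_unbounded_of_one_lt (‖u - v‖ / ((1 - Real.cos α) / 8 * ε))
      (show (1 : ℝ) < 3 / 2 by norm_num)
    have key := intrinsicDist_add_smul_le hD hr hα1 hcos hm hmc hε hεδ n u (subset_closure hu) v
      (subset_closure hv) huv1 hmid ((div_lt_iff₀ hc0).1 hn).le
    have t1 := intrinsicDist_triangle D u (u + ε • m) v
    have t2 := intrinsicDist_triangle D (u + ε • m) (v + ε • m) v
    have s1 := hshift u hu (by linarith) ε hε hεδ
    have s2 := hshift v hv hvx ε hε hεδ
    rw [intrinsicDist_comm] at s2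
    calc intrinsicDist D u v
        ≤ ENNReal.ofReal ε + (ENNReal.ofReal (‖u - v‖ + (r ^ 2)⁻¹ * ‖u - v‖ ^ 3) +
          ENNReal.ofReal ε) := t1.trans (add_le_add s1 (t2.trans (add_le_add key s2)))
      _ = ENNReal.ofReal (‖u - v‖ + (r ^ 2)⁻¹ * ‖u - v‖ ^ 3) +
          (ENNReal.ofReal ε + ENNReal.ofReal ε) := by abel
      _ ≤ _ := by
        gcongr
        rw [← ENNReal.ofReal_add hε.le hε.le, ← ENNReal.ofReal_coe_nnreal (p := ε')]
        refine ENNReal.ofReal_le_ofReal ?_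
        have : ε ≤ (ε' : ℝ) / 2 := min_le_left _ _
        linarith
  · push Not at hnear
    have hball : Metric.ball u (δ / 16) ⊆ D := by
      refine (convex_ball u (δ / 16)).isPreconnected.subset_left_of_subset_union hD
        isClosed_closure.isOpen_compl (disjoint_compl_right_iff_subset.2 subset_closure) ?_
        ⟨u, Metric.mem_ball_self (by positivity), hu⟩
      intro q hq
      by_contra hcon
      rw [mem_union, not_or, notMem_compl_iff] at hcon
      have hqf : q ∈ frontier D := ⟨hcon.2, by rw [hD.interior_eq]; exact hcon.1⟩
      have := hnear q hqf
      rw [Metric.mem_ball, dist_comm, dist_eq_norm] at hq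
      linarith
    have hseg : segment ℝ u v ⊆ D := by
      refine ((convex_ball u (δ / 16)).segment_subset (Metric.mem_ball_self (by positivity))
        ?_).trans hball
      rw [Metric.mem_ball, dist_comm, dist_eq_norm]
      linarith
    refine (intrinsicDist_le_of_segment_subset hseg).trans ?_
    rw [edist_dist, dist_eq_norm]
    refine ENNReal.ofReal_le_ofReal ?_
    have : 0 ≤ (r ^ 2)⁻¹ * ‖u - v‖ ^ 3 := by positivity
    linarith

end Boundary

/-! ### The closure of a domain with the intrinsic metric -/

section ClosureDist

variable {d : ℕ}

/-- A domain in which the intrinsic distance of two close points exceeds the length of their chord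
at most by a cubic term. -/
class IsArcChordDomain (D : Set (EuclideanSpace ℝ (Fin d))) : Prop where
  isOpen : IsOpen D
  isConnected : IsConnected D
  exists_le : ∃ s₀ > 0, ∃ C ≥ 0, ∀ u ∈ D, ∀ v ∈ D, ‖u - v‖ ≤ s₀ →
    intrinsicDist D u v ≤ ENNReal.ofReal (‖u - v‖ + C * ‖u - v‖ ^ 3)

/-- The closure of `D`, to be equipped with the extension of the intrinsic distance. -/
@[ext]
structure IntrinsicClosure (D : Set (EuclideanSpace ℝ (Fin d))) where
  /-- The underlying point of the Euclidean space. -/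
  val : EuclideanSpace ℝ (Fin d)
  mem : val ∈ closure D

variable (D : Set (EuclideanSpace ℝ (Fin d)))

theorem intrinsicDist_self {u : EuclideanSpace ℝ (Fin d)} (hu : u ∈ D) :
    intrinsicDist D u u = 0 := by
  have := intrinsicDist_le_of_segment_subset (D := D) (x := u) (y := u)
    (by rw [segment_same]; exact singleton_subset_iff.2 hu)
  rw [edist_self] at this
  exact le_antisymm this zero_le

variable [hD : IsArcChordDomain D]

variable {D} in
theorem intrinsicDist_ne_top {u v : EuclideanSpace ℝ (Fin d)} (hu : u ∈ D) (hv : v ∈ D) :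
    intrinsicDist D u v ≠ ⊤ := by
  obtain ⟨s₀, hs₀, C, hC, hle⟩ := hD.exists_le
  refine hD.isConnected.isPreconnected.induction₂ (fun u v => intrinsicDist D u v ≠ ⊤)
    (fun x hx => ?_) (fun x y z _ _ _ h1 h2 => ?_) (fun x y _ _ h => ?_) hu hv
  · filter_upwards [self_mem_nhdsWithin, mem_nhdsWithin_of_mem_nhds (Metric.ball_mem_nhds x hs₀)]
      with y hy hy2
    rw [Metric.mem_ball, dist_comm, dist_eq_norm] at hy2
    exact ((hle x hx y hy hy2.le).trans_lt ENNReal.ofReal_lt_top).ne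
  · exact ((intrinsicDist_triangle D x y z).trans_lt
      (ENNReal.add_lt_top.2 ⟨h1.lt_top, h2.lt_top⟩)).ne
  · rwa [intrinsicDist_comm]

theorem uniformContinuousOn_intrinsicDist :
    UniformContinuousOn (fun p : EuclideanSpace ℝ (Fin d) × EuclideanSpace ℝ (Fin d) =>
      (intrinsicDist D p.1 p.2).toReal) (D ×ˢ D) := by
  obtain ⟨s₀, hs₀, C, hC, hle⟩ := hD.exists_le
  have hM : 0 < 1 + C * s₀ ^ 2 := by positivity
  rw [Metric.uniformContinuousOn_iff]
  intro ε hε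
  refine ⟨min s₀ (ε / (2 * (1 + C * s₀ ^ 2))), by positivity, ?_⟩
  have hclose : ∀ u ∈ D, ∀ v ∈ D, dist u v < min s₀ (ε / (2 * (1 + C * s₀ ^ 2))) →
      (intrinsicDist D u v).toReal < ε / 2 := by
    intro u hu v hv h
    rw [dist_eq_norm, lt_min_iff, lt_div_iff₀ (by positivity)] at h
    have h1 := ENNReal.toReal_mono ENNReal.ofReal_ne_top (hle u hu v hv h.1.le)
    rw [ENNReal.toReal_ofReal (by positivity)] at h1
    have h2 : ‖u - v‖ ^ 2 ≤ s₀ ^ 2 := pow_le_pow_left₀ (norm_nonneg _) h.1.le 2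
    have h3 := mul_le_mul_of_nonneg_left h2 (mul_nonneg hC (norm_nonneg (u - v)))
    nlinarith
  have hone : ∀ u ∈ D, ∀ v ∈ D, ∀ u' ∈ D, ∀ v' ∈ D, (intrinsicDist D u v).toReal ≤
      (intrinsicDist D u u').toReal + (intrinsicDist D u' v').toReal +
        (intrinsicDist D v v').toReal := by
    intro u hu v hv u' hu' v' hv'
    rw [intrinsicDist_comm D v v', ← ENNReal.toReal_add (intrinsicDist_ne_top hu hu')
      (intrinsicDist_ne_top hu' hv'), ← ENNReal.toReal_add (ENNReal.add_ne_top.2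
        ⟨intrinsicDist_ne_top hu hu', intrinsicDist_ne_top hu' hv'⟩) (intrinsicDist_ne_top hv' hv)]
    refine ENNReal.toReal_mono (ENNReal.add_ne_top.2 ⟨ENNReal.add_ne_top.2
        ⟨intrinsicDist_ne_top hu hu', intrinsicDist_ne_top hu' hv'⟩, intrinsicDist_ne_top hv' hv⟩)
      ?_
    refine (intrinsicDist_triangle D u u' v).trans ?_
    rw [add_assoc]
    gcongr
    exact intrinsicDist_triangle D u' v' v
  rintro ⟨u, v⟩ ⟨hu, hv⟩ ⟨u', v'⟩ ⟨hu', hv'⟩ h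
  rw [Prod.dist_eq, max_lt_iff] at h
  simp only at h hu hv hu' hv' ⊢
  have e1 := hclose u hu u' hu' h.1
  have e2 := hclose v hv v' hv' h.2
  have e3 := hone u hu v hv u' hu' v' hv'
  have e4 := hone u' hu' v' hv' u hu v hv
  rw [intrinsicDist_comm D u' u, intrinsicDist_comm D v' v] at e4
  rw [Real.dist_eq, abs_lt]
  constructor <;> linarith

variable {D}

theorem exists_tendsto_intrinsicDist {x y : EuclideanSpace ℝ (Fin d)} (hx : x ∈ closure D)
    (hy : y ∈ closure D) :
    ∃ L : ℝ, Tendsto (fun p : EuclideanSpace ℝ (Fin d) × EuclideanSpace ℝ (Fin d) =>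
      intrinsicDist D p.1 p.2) (𝓝[D ×ˢ D] (x, y)) (𝓝 (ENNReal.ofReal L)) := by
  have hmem : (x, y) ∈ closure (D ×ˢ D) := by
    rw [closure_prod_eq]
    exact ⟨hx, hy⟩
  have := mem_closure_iff_nhdsWithin_neBot.1 hmem
  have hcau : Cauchy (𝓝[D ×ˢ D] (x, y)) := cauchy_nhds.mono nhdsWithin_le_nhds
  obtain ⟨L, hL⟩ := CompleteSpace.complete (hcau.map_of_le (uniformContinuousOn_intrinsicDist D)
    (le_principal_iff.2 self_mem_nhdsWithin))
  refine ⟨L, (ENNReal.tendsto_ofReal hL).congr' ?_⟩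
  filter_upwards [self_mem_nhdsWithin] with p hp
  exact ENNReal.ofReal_toReal (intrinsicDist_ne_top hp.1 hp.2)

theorem tendsto_intrinsicDist_nhdsWithin {x y : EuclideanSpace ℝ (Fin d)} (hx : x ∈ closure D)
    (hy : y ∈ closure D) :
    Tendsto (fun p : EuclideanSpace ℝ (Fin d) × EuclideanSpace ℝ (Fin d) =>
      intrinsicDist D p.1 p.2) (𝓝[D ×ˢ D] (x, y)) (𝓝 (closureDist D x y)) := by
  obtain ⟨L, hL⟩ := exists_tendsto_intrinsicDist hx hy
  exact tendsto_extendFrom ⟨_, hL⟩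

theorem closureDist_ne_top {x y : EuclideanSpace ℝ (Fin d)} (hx : x ∈ closure D)
    (hy : y ∈ closure D) : closureDist D x y ≠ ⊤ := by
  obtain ⟨L, hL⟩ := exists_tendsto_intrinsicDist hx hy
  have hmem : (x, y) ∈ closure (D ×ˢ D) := by
    rw [closure_prod_eq]
    exact ⟨hx, hy⟩
  have := mem_closure_iff_nhdsWithin_neBot.1 hmem
  rw [tendsto_nhds_unique (tendsto_intrinsicDist_nhdsWithin hx hy) hL]
  exact ENNReal.ofReal_ne_top

theorem tendsto_intrinsicDist {x y : EuclideanSpace ℝ (Fin d)} (hx : x ∈ closure D)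
    (hy : y ∈ closure D) {T : Type*} {l : Filter T} {u v : T → EuclideanSpace ℝ (Fin d)}
    (hu : Tendsto u l (𝓝 x)) (hv : Tendsto v l (𝓝 y)) (huD : ∀ n, u n ∈ D) (hvD : ∀ n, v n ∈ D) :
    Tendsto (fun n => (intrinsicDist D (u n) (v n)).toReal) l (𝓝 (closureDist D x y).toReal) := by
  have h3 : Tendsto (fun n => (u n, v n)) l (𝓝[D ×ˢ D] (x, y)) :=
    tendsto_nhdsWithin_iff.2 ⟨Tendsto.prodMk_nhds hu hv,
      Eventually.of_forall fun n => mk_mem_prod (huD n) (hvD n)⟩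
  have h4 := (tendsto_intrinsicDist_nhdsWithin hx hy).comp h3
  have h5 := (ENNReal.tendsto_toReal (closureDist_ne_top hx hy)).comp h4
  exact h5

theorem closureDist_of_mem {x y : EuclideanSpace ℝ (Fin d)} (hx : x ∈ D) (hy : y ∈ D) :
    (closureDist D x y).toReal = (intrinsicDist D x y).toReal :=
  (tendsto_nhds_unique (tendsto_const_nhds (x := (intrinsicDist D x y).toReal) (f := pure ()))
    (tendsto_intrinsicDist (subset_closure hx) (subset_closure hy)
      (tendsto_const_nhds (f := pure ()))
      tendsto_const_nhds (fun _ => hx) (fun _ => hy))).symm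

theorem norm_sub_le_closureDist {x y : EuclideanSpace ℝ (Fin d)} (hx : x ∈ closure D)
    (hy : y ∈ closure D) : ‖x - y‖ ≤ (closureDist D x y).toReal := by
  obtain ⟨u, huD, hu⟩ := mem_closure_iff_seq_limit.1 hx
  obtain ⟨v, hvD, hv⟩ := mem_closure_iff_seq_limit.1 hy
  refine le_of_tendsto_of_tendsto (hu.sub hv).norm (tendsto_intrinsicDist hx hy hu hv huD hvD)
    (Eventually.of_forall fun n => ?_)
  have := ENNReal.toReal_mono (intrinsicDist_ne_top (huD n) (hvD n))
    (edist_le_intrinsicDist (D := D) (x := u n) (y := v n))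
  rwa [edist_dist, ENNReal.toReal_ofReal dist_nonneg, dist_eq_norm] at this

variable (D) in
/-- The intrinsic distance extended by continuity to the closure. It vanishes only on the diagonal
since it dominates the Euclidean distance. -/
noncomputable instance : MetricSpace (IntrinsicClosure D) where
  dist x y := (closureDist D x.val y.val).toReal
  dist_self x := by
    obtain ⟨u, huD, hu⟩ := mem_closure_iff_seq_limit.1 x.mem
    refine tendsto_nhds_unique (tendsto_intrinsicDist x.mem x.mem hu hu huD huD) ?_
    simp only [intrinsicDist_self D (huD _), ENNReal.toReal_zero]
    exact tendsto_const_nhds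
  dist_comm x y := by
    obtain ⟨u, huD, hu⟩ := mem_closure_iff_seq_limit.1 x.mem
    obtain ⟨v, hvD, hv⟩ := mem_closure_iff_seq_limit.1 y.mem
    refine tendsto_nhds_unique (tendsto_intrinsicDist x.mem y.mem hu hv huD hvD) ?_
    simpa only [intrinsicDist_comm D (v _)] using
      tendsto_intrinsicDist y.mem x.mem hv hu hvD huD
  dist_triangle x y z := by
    obtain ⟨u, huD, hu⟩ := mem_closure_iff_seq_limit.1 x.mem
    obtain ⟨v, hvD, hv⟩ := mem_closure_iff_seq_limit.1 y.mem
    obtain ⟨w, hwD, hw⟩ := mem_closure_iff_seq_limit.1 z.mem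
    refine le_of_tendsto_of_tendsto (tendsto_intrinsicDist x.mem z.mem hu hw huD hwD)
      ((tendsto_intrinsicDist x.mem y.mem hu hv huD hvD).add
        (tendsto_intrinsicDist y.mem z.mem hv hw hvD hwD)) (Eventually.of_forall fun n => ?_)
    have h1 := intrinsicDist_ne_top (huD n) (hvD n)
    have h2 := intrinsicDist_ne_top (hvD n) (hwD n)
    dsimp only
    rw [← ENNReal.toReal_add h1 h2]
    exact ENNReal.toReal_mono (ENNReal.add_ne_top.2 ⟨h1, h2⟩) (intrinsicDist_triangle D _ _ _)
  eq_of_dist_eq_zero := by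
    intro x y h
    have h1 := norm_sub_le_closureDist x.mem y.mem
    have h2 : ‖x.val - y.val‖ = 0 := le_antisymm (h1.trans_eq h) (norm_nonneg _)
    exact IntrinsicClosure.ext (sub_eq_zero.1 (norm_eq_zero.1 h2))

namespace IntrinsicClosure

theorem dist_def (x y : IntrinsicClosure D) : dist x y = (closureDist D x.val y.val).toReal := rfl

theorem closureDist_val (x y : IntrinsicClosure D) :
    closureDist D x.val y.val = ENNReal.ofReal (dist x y) := by
  rw [dist_def, ENNReal.ofReal_toReal (closureDist_ne_top x.mem y.mem)]

theorem exists_isArcChordEmbedding :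
    ∃ s₀ C : ℝ, IsArcChordEmbedding (val : IntrinsicClosure D → EuclideanSpace ℝ (Fin d)) s₀ C := by
  obtain ⟨s₀, hs₀, C, hC, hle⟩ := hD.exists_le
  refine ⟨s₀ / 2, C, by linarith, hC, fun x y => norm_sub_le_closureDist x.mem y.mem,
    fun x y hxy => ?_, ?_⟩
  · obtain ⟨u, huD, hu⟩ := mem_closure_iff_seq_limit.1 x.mem
    obtain ⟨v, hvD, hv⟩ := mem_closure_iff_seq_limit.1 y.mem
    have hn := (hu.sub hv).norm
    refine le_of_tendsto_of_tendsto (tendsto_intrinsicDist x.mem y.mem hu hv huD hvD)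
      (hn.add ((hn.pow 3).const_mul C)) ?_
    filter_upwards [hn.eventually (gt_mem_nhds (show ‖x.val - y.val‖ < s₀ by linarith))] with n hn'
    have := ENNReal.toReal_mono ENNReal.ofReal_ne_top (hle _ (huD n) _ (hvD n) hn'.le)
    rwa [ENNReal.toReal_ofReal (by positivity)] at this
  · have : range (val : IntrinsicClosure D → EuclideanSpace ℝ (Fin d)) = closure D :=
      Subset.antisymm (range_subset_iff.2 fun x => x.mem) fun x hx => ⟨⟨x, hx⟩, rfl⟩
    rw [this]
    exact isClosed_closure

end IntrinsicClosure

end ClosureDist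

/-! ### Geodesics and the `CAT(0)` inequality in the closure -/

section Comparison

theorem exists_comparison_triangle {A B C : ℝ} (hA : 0 ≤ A) (hB : 0 ≤ B) (hC : 0 ≤ C)
    (h1 : A ≤ B + C) (h2 : B ≤ A + C) (h3 : C ≤ A + B) :
    ∃ a b c : EuclideanSpace ℝ (Fin 2), dist a b = A ∧ dist a c = B ∧ dist b c = C := by
  have hdist : ∀ x y x' y' r : ℝ, 0 ≤ r → (x - x') ^ 2 + (y - y') ^ 2 = r ^ 2 →
      dist (!₂[x, y] : EuclideanSpace ℝ (Fin 2)) !₂[x', y'] = r := by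
    intro x y x' y' r hr h
    rw [EuclideanSpace.dist_eq, Fin.sum_univ_two]
    simp [Real.dist_eq, h, Real.sqrt_sq hr]
  rcases eq_or_lt_of_le hA with rfl | hA0
  · have hBC : B = C := by linarith
    exact ⟨!₂[0, 0], !₂[0, 0], !₂[B, 0], by simp, hdist _ _ _ _ _ hB (by ring),
      hdist _ _ _ _ _ hC (by rw [hBC]; ring)⟩
  · set u := (A ^ 2 + B ^ 2 - C ^ 2) / (2 * A) with hu
    have huA : 2 * A * u = A ^ 2 + B ^ 2 - C ^ 2 := by
      rw [hu]
      field_simp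
    have hw : 0 ≤ B ^ 2 - u ^ 2 := by
      have e1 : 0 ≤ (C + A - B) * (C + B - A) * (A + B - C) * (A + B + C) := by
        have := sub_nonneg.2 h1
        have := sub_nonneg.2 h2
        have := sub_nonneg.2 h3
        refine mul_nonneg (mul_nonneg (mul_nonneg ?_ ?_) ?_) ?_ <;> linarith
      have e2 : 4 * A ^ 2 * (B ^ 2 - u ^ 2) =
          (C + A - B) * (C + B - A) * (A + B - C) * (A + B + C) := by
        linear_combination (-(2 * A * u) - (A ^ 2 + B ^ 2 - C ^ 2)) * huA
      by_contra hneg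
      push Not at hneg
      nlinarith [mul_pos (pow_pos hA0 2) (neg_pos.2 hneg)]
    refine ⟨!₂[0, 0], !₂[A, 0], !₂[u, √(B ^ 2 - u ^ 2)], hdist _ _ _ _ _ hA (by ring),
      hdist _ _ _ _ _ hB ?_, hdist _ _ _ _ _ hC ?_⟩
    · rw [zero_sub, zero_sub, neg_sq, neg_sq, Real.sq_sqrt hw]
      ring
    · rw [zero_sub, neg_sq, Real.sq_sqrt hw]
      linarith

/-- Stewart's theorem. -/
theorem dist_lineMap_sq {V : Type*} [NormedAddCommGroup V] [InnerProductSpace ℝ V] (a b c : V)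
    (l : ℝ) : dist (AffineMap.lineMap a b l) c ^ 2 =
      (1 - l) * dist a c ^ 2 + l * dist b c ^ 2 - l * (1 - l) * dist a b ^ 2 := by
  simp only [dist_eq_norm]
  have e1 : AffineMap.lineMap a b l - c = (1 - l) • (a - c) + l • (b - c) := by
    rw [AffineMap.lineMap_apply_module']
    module
  have e2 : a - b = (a - c) - (b - c) := by abel
  rw [e1, e2]
  generalize a - c = x
  generalize b - c = y
  rw [norm_add_sq_real, norm_sub_sq_real, norm_smul, norm_smul, real_inner_smul_left,
    real_inner_smul_right, mul_pow, mul_pow, Real.norm_eq_abs, Real.norm_eq_abs, sq_abs, sq_abs]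
  ring

end Comparison

section Geodesics

variable {d : ℕ} {D : Set (EuclideanSpace ℝ (Fin d))} [hD : IsArcChordDomain D]

namespace IntrinsicClosure

theorem ofReal_dist_eq_intrinsicDist {a b : IntrinsicClosure D} (ha : a.val ∈ D) (hb : b.val ∈ D) :
    ENNReal.ofReal (dist a b) = intrinsicDist D a.val b.val := by
  rw [dist_def, closureDist_of_mem ha hb, ENNReal.ofReal_toReal (intrinsicDist_ne_top ha hb)]

/-- Two points of `D` are joined by a path of almost minimal length. Its points `f s` are indexed
by their distance `s` from the starting point. -/
theorem exists_approximate_geodesic {a b : IntrinsicClosure D} (ha : a.val ∈ D) (hb : b.val ∈ D)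
    {ε : ℝ} (hε : 0 < ε) :
    ∃ f : ℝ → IntrinsicClosure D, ∀ s ∈ Icc 0 (dist a b), dist a (f s) = s ∧
      dist (f s) b ≤ dist a b - s + ε ∧
      ∀ t ∈ Icc 0 (dist a b), dist (f s) (f t) ≤ |s - t| + ε := by
  obtain ⟨s₀, C, hι⟩ := exists_isArcChordEmbedding (D := D)
  set L := dist a b with hL
  have hL0 : 0 ≤ L := dist_nonneg
  have hlt : intrinsicDist D a.val b.val < ENNReal.ofReal (L + ε) := by
    rw [← ofReal_dist_eq_intrinsicDist ha hb]
    exact (ENNReal.ofReal_lt_ofReal_iff (by linarith)).2 (by linarith)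
  obtain ⟨γ, hγ, hvar⟩ := exists_isSmoothPath_of_intrinsicDist_lt hlt
  classical
  set g : ℝ → IntrinsicClosure D := fun t => if h : γ t ∈ closure D then ⟨γ t, h⟩ else a with hg
  have hgval : ∀ t ∈ Icc (0 : ℝ) 1, (g t).val = γ t := by
    intro t ht
    simp only [hg, dif_pos (subset_closure (hγ.2.1 ht))]
  have hgD : ∀ t ∈ Icc (0 : ℝ) 1, (g t).val ∈ D := fun t ht => hgval t ht ▸ hγ.2.1 ht
  have h0 : (0 : ℝ) ∈ Icc (0 : ℝ) 1 := ⟨le_rfl, zero_le_one⟩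
  have h1 : (1 : ℝ) ∈ Icc (0 : ℝ) 1 := ⟨zero_le_one, le_rfl⟩
  have hg0 : g 0 = a := IntrinsicClosure.ext (by rw [hgval 0 h0, hγ.2.2.1])
  have hg1 : g 1 = b := IntrinsicClosure.ext (by rw [hgval 1 h1, hγ.2.2.2])
  have hcont : ContinuousOn g (Icc 0 1) := by
    intro t ht
    refine hι.tendsto_iff.2 ?_
    rw [hgval t ht]
    refine (hγ.1.continuousOn t ht).congr' ?_
    filter_upwards [self_mem_nhdsWithin] with r hr
    exact (hgval r hr).symm
  have hle : ∀ s ∈ Icc (0 : ℝ) 1, ∀ t ∈ Icc (0 : ℝ) 1, s ≤ t →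
      ENNReal.ofReal (dist (g s) (g t)) ≤ eVariationOn γ (Icc s t) := by
    intro s hs t ht hst
    rw [ofReal_dist_eq_intrinsicDist (hgD s hs) (hgD t ht), hgval s hs, hgval t ht]
    exact hγ.intrinsicDist_le_eVariationOn hs ht hst
  have hsum : ∀ s ∈ Icc (0 : ℝ) 1, ∀ t ∈ Icc (0 : ℝ) 1, s ≤ t →
      dist a (g s) + dist (g s) (g t) + dist (g t) b ≤ L + ε := by
    intro s hs t ht hst
    have e1 := eVariationOn.Icc_add_Icc γ (s := univ) hs.1 hst (mem_univ _)
    have e2 := eVariationOn.Icc_add_Icc γ (s := univ) (hs.1.trans hst) ht.2 (mem_univ _)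
    simp only [univ_inter] at e1 e2
    have e3 := add_le_add (add_le_add (hle 0 h0 s hs hs.1) (hle s hs t ht hst)) (hle t ht 1 h1 ht.2)
    rw [e1, e2, hg0, hg1, ← ENNReal.ofReal_add dist_nonneg dist_nonneg,
      ← ENNReal.ofReal_add (by positivity) dist_nonneg] at e3
    exact (ENNReal.ofReal_le_ofReal_iff (by linarith)).1 (e3.trans hvar.le)
  have hivt : ∀ s ∈ Icc 0 L, ∃ t ∈ Icc (0 : ℝ) 1, dist a (g t) = s := by
    intro s hs
    have hc : ContinuousOn (fun t => dist a (g t)) (Icc 0 1) :=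
      fun t ht => Tendsto.dist tendsto_const_nhds (hcont t ht)
    have := intermediate_value_Icc zero_le_one hc
    simp only [hg0, hg1, dist_self] at this
    exact this hs
  choose! θ hθ hθ' using hivt
  have hone : ∀ s ∈ Icc 0 L, ∀ t ∈ Icc 0 L, θ s ≤ θ t →
      dist (g (θ s)) (g (θ t)) ≤ |s - t| + ε := by
    intro s hs t ht hst
    have e1 := hsum _ (hθ s hs) _ (hθ t ht) hst
    have e2 := dist_triangle a (g (θ t)) b
    rw [hθ' t ht, ← hL] at e2
    rw [hθ' s hs] at e1
    have e3 := neg_abs_le (s - t)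
    linarith
  refine ⟨fun s => g (θ s), fun s hs => ⟨hθ' s hs, ?_, fun t ht => ?_⟩⟩
  · have e1 := hsum _ (hθ s hs) _ (hθ s hs) le_rfl
    rw [hθ' s hs, dist_self] at e1
    linarith
  · rcases le_total (θ s) (θ t) with h | h
    · exact hone s hs t ht h
    · rw [dist_comm, abs_sub_comm]
      exact hone t ht s hs h

/-- Two points of `D` are joined by a geodesic in the closure, as a limit of paths of almost minimal
length. -/
theorem exists_geodesic {a b : IntrinsicClosure D} (ha : a.val ∈ D) (hb : b.val ∈ D) :
    ∃ Γ : ℝ → IntrinsicClosure D, Γ 0 = a ∧ Γ (dist a b) = b ∧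
      ∀ s ∈ Icc 0 (dist a b), ∀ t ∈ Icc 0 (dist a b), dist (Γ s) (Γ t) = |s - t| := by
  obtain ⟨s₀, C, hι⟩ := exists_isArcChordEmbedding (D := D)
  choose f hf using fun n : ℕ =>
    exists_approximate_geodesic ha hb (ε := 1 / ((n : ℝ) + 1)) Nat.one_div_pos_of_nat
  set L := dist a b with hL
  have hL0 : 0 ≤ L := dist_nonneg
  let l : Ultrafilter ℕ := hyperfilter ℕ
  have hl : (l : Filter ℕ) ≤ atTop := by
    rw [← Nat.cofinite_eq_atTop]
    exact hyperfilter_le_cofinite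
  have hex : ∀ s ∈ Icc 0 L, ∃ z, Tendsto (fun n => f n s) l (𝓝 z) := fun s hs =>
    hι.exists_tendsto l (x := a) (R := s) (Eventually.of_forall fun n => by
      rw [dist_comm, (hf n s hs).1])
  have : Nonempty (IntrinsicClosure D) := ⟨a⟩
  choose! Γ hΓ using hex
  have hε : Tendsto (fun n : ℕ => 1 / ((n : ℝ) + 1)) l (𝓝 0) :=
    tendsto_one_div_add_atTop_nhds_zero_nat.mono_left hl
  have hle : ∀ s ∈ Icc 0 L, ∀ t ∈ Icc 0 L, dist (Γ s) (Γ t) ≤ |s - t| := by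
    intro s hs t ht
    refine le_of_tendsto_of_tendsto ((hΓ s hs).dist (hΓ t ht)) (hε.const_add |s - t|)
      (Eventually.of_forall fun n => (hf n s hs).2.2 t ht) |>.trans_eq ?_
    rw [add_zero]
  have hda : ∀ s ∈ Icc 0 L, dist a (Γ s) = s := fun s hs =>
    tendsto_nhds_unique (tendsto_const_nhds.dist (hΓ s hs))
      (tendsto_const_nhds.congr fun n => ((hf n s hs).1).symm)
  have hdb : ∀ s ∈ Icc 0 L, dist (Γ s) b ≤ L - s := by
    intro s hs
    refine le_of_tendsto_of_tendsto ((hΓ s hs).dist tendsto_const_nhds) (hε.const_add (L - s))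
      (Eventually.of_forall fun n => (hf n s hs).2.1) |>.trans_eq ?_
    rw [add_zero]
  have hge : ∀ s ∈ Icc 0 L, ∀ t ∈ Icc 0 L, s ≤ t → t - s ≤ dist (Γ s) (Γ t) := by
    intro s hs t ht hst
    have e1 := dist_triangle4 a (Γ s) (Γ t) b
    rw [hda s hs, ← hL] at e1
    have e2 := hdb t ht
    linarith
  refine ⟨Γ, ?_, ?_, fun s hs t ht => le_antisymm (hle s hs t ht) ?_⟩
  · exact (dist_eq_zero.1 (hda 0 ⟨le_rfl, hL0⟩)).symm
  · have := hdb L ⟨hL0, le_rfl⟩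
    rw [sub_self] at this
    exact dist_le_zero.1 this
  · rcases le_total s t with h | h
    · rw [abs_sub_comm, abs_of_nonneg (by linarith)]
      exact hge s hs t ht h
    · rw [dist_comm, abs_of_nonneg (by linarith)]
      exact hge t ht s hs h

/-- An isometric path in the closure is an intrinsic geodesic. -/
theorem isIntrinsicGeodesic_val {Γ : ℝ → IntrinsicClosure D} {a b : IntrinsicClosure D}
    (h0 : Γ 0 = a) (h1 : Γ (dist a b) = b)
    (h : ∀ s ∈ Icc 0 (dist a b), ∀ t ∈ Icc 0 (dist a b), dist (Γ s) (Γ t) = |s - t|) :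
    IsIntrinsicGeodesic D (fun t => (Γ t).val) (dist a b) a.val b.val where
  nonneg := dist_nonneg
  left := congrArg val h0
  right := congrArg val h1
  mem t _ := (Γ t).mem
  dist_eq s hs t ht := by rw [closureDist_val, h s hs t ht]

theorem exists_isDivisionPoint (hcat : IsCAT0Domain D) {a b : IntrinsicClosure D} (ha : a.val ∈ D)
    (hb : b.val ∈ D) {l : ℝ} (hl : l ∈ Icc (0 : ℝ) 1) :
    ∃ z : IntrinsicClosure D, ∀ p : IntrinsicClosure D, p.val ∈ D → dist p z ^ 2 ≤
      (1 - l) * dist p a ^ 2 + l * dist p b ^ 2 - l * (1 - l) * dist a b ^ 2 := by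
  obtain ⟨Γ, h0, h1, hΓ⟩ := exists_geodesic ha hb
  refine ⟨Γ (l * dist a b), fun p hp => ?_⟩
  obtain ⟨Γ₁, h10, h11, hΓ₁⟩ := exists_geodesic ha hp
  obtain ⟨Γ₂, h20, h21, hΓ₂⟩ := exists_geodesic hb hp
  have t1 := dist_triangle a p b
  have t2 := dist_triangle a b p
  have t3 := dist_triangle b a p
  rw [dist_comm p b] at t1
  rw [dist_comm b a] at t3
  obtain ⟨a', b', c', hab, hac, hbc⟩ := exists_comparison_triangle (A := dist a b)
    (B := dist a p) (C := dist b p) dist_nonneg dist_nonneg dist_nonneg t1 t2 t3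
  have hls : l * dist a b ∈ Icc 0 (dist a b) :=
    ⟨mul_nonneg hl.1 dist_nonneg, mul_le_of_le_one_left dist_nonneg hl.2⟩
  have key := hcat _ ha _ hb _ hp _ _ _ _ _ _ (isIntrinsicGeodesic_val h0 h1 hΓ)
    (isIntrinsicGeodesic_val h10 h11 hΓ₁) (isIntrinsicGeodesic_val h20 h21 hΓ₂) a' b' c' hab hac hbc
    _ hls _ ⟨dist_nonneg, le_rfl⟩ (AffineMap.lineMap a' b' l)
    (by rw [segment_eq_image_lineMap]; exact mem_image_of_mem _ hl) c' (right_mem_segment ℝ a' c')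
    (by rw [dist_left_lineMap, hab, Real.norm_of_nonneg hl.1]) hac
  rw [closureDist_val, h11, ENNReal.ofReal_le_ofReal_iff dist_nonneg] at key
  have h2 := pow_le_pow_left₀ dist_nonneg key 2
  rw [dist_lineMap_sq, hab, hac, hbc] at h2
  rwa [dist_comm p, dist_comm p a, dist_comm p b]

theorem exists_seq_tendsto (x : IntrinsicClosure D) :
    ∃ u : ℕ → IntrinsicClosure D, (∀ n, (u n).val ∈ D) ∧ Tendsto u atTop (𝓝 x) := by
  obtain ⟨s₀, C, hι⟩ := exists_isArcChordEmbedding (D := D)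
  obtain ⟨u, huD, hu⟩ := mem_closure_iff_seq_limit.1 x.mem
  exact ⟨fun n => ⟨u n, subset_closure (huD n)⟩, huD, hι.tendsto_iff.2 hu⟩

/-- The comparison inequality passes from triangles in `D` to triangles in the closure. -/
theorem isCAT0Space (hcat : IsCAT0Domain D) : IsCAT0Space (IntrinsicClosure D) := by
  intro a b l hl
  obtain ⟨s₀, C, hι⟩ := exists_isArcChordEmbedding (D := D)
  obtain ⟨u, huD, hu⟩ := exists_seq_tendsto a
  obtain ⟨v, hvD, hv⟩ := exists_seq_tendsto b
  choose z hz using fun n => exists_isDivisionPoint hcat (huD n) (hvD n) hl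
  let U : Ultrafilter ℕ := hyperfilter ℕ
  have hU : (U : Filter ℕ) ≤ atTop := by
    rw [← Nat.cofinite_eq_atTop]
    exact hyperfilter_le_cofinite
  have hbound : ∀ n, dist (z n) (u n) ≤ dist (u n) (v n) := by
    intro n
    have := hz n (u n) (huD n)
    rw [dist_self] at this
    rw [dist_comm]
    refine abs_le_of_sq_le_sq' (this.trans ?_) dist_nonneg |>.2
    have h1 : 0 ≤ dist (u n) (v n) ^ 2 := sq_nonneg _
    have h2 : l ^ 2 ≤ 1 := pow_le_one₀ hl.1 hl.2
    nlinarith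
  obtain ⟨w, hw⟩ := hι.exists_tendsto U (p := z) (x := a) (R := dist a b + 1 + 1) (by
    filter_upwards [hU ((hu.dist hv).eventually (gt_mem_nhds (lt_add_one (dist a b)))),
      hU (Metric.tendsto_nhds.1 hu 1 one_pos)] with n h1 h2
    exact (dist_triangle _ (u n) _).trans (add_le_add ((hbound n).trans h1.le) h2.le))
  have hu' := hu.mono_left hU
  have hv' := hv.mono_left hU
  have hDp : ∀ p : IntrinsicClosure D, p.val ∈ D → dist p w ^ 2 ≤
      (1 - l) * dist p a ^ 2 + l * dist p b ^ 2 - l * (1 - l) * dist a b ^ 2 := by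
    intro p hp
    exact le_of_tendsto_of_tendsto ((tendsto_const_nhds.dist hw).pow 2)
      (((((tendsto_const_nhds.dist hu').pow 2).const_mul (1 - l)).add
        (((tendsto_const_nhds.dist hv').pow 2).const_mul l)).sub
          (((hu'.dist hv').pow 2).const_mul (l * (1 - l))))
      (Eventually.of_forall fun n => hz n p hp)
  refine ⟨w, fun p => ?_⟩
  obtain ⟨q, hqD, hq⟩ := exists_seq_tendsto p
  exact le_of_tendsto_of_tendsto ((hq.dist tendsto_const_nhds).pow 2)
    (((((hq.dist tendsto_const_nhds).pow 2).const_mul (1 - l)).add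
      (((hq.dist tendsto_const_nhds).pow 2).const_mul l)).sub_const _)
    (Eventually.of_forall fun n => hDp (q n) (hqD n))

end IntrinsicClosure

end Geodesics

/-! ### Weak solutions of the pursuit equation -/

section PursuitEquation

/-- A continuous path that meets neither a right-continuous path nor its left limits stays at a
positive distance from it on compact time intervals. -/
theorem exists_pos_le_dist {V : Type*} [MetricSpace V] {x y : ℝ → V} {T : ℝ}
    (hx : ContinuousOn x (Icc 0 T)) (hy : ∀ t ∈ Icc 0 T, ContinuousWithinAt y (Ici t) t)
    (hleft : ∀ t ∈ Ioc 0 T, ∃ l, Tendsto y (𝓝[<] t) (𝓝 l)) (hne : ∀ t ∈ Icc 0 T, x t ≠ y t)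
    (hne' : ∀ t ∈ Ioc 0 T, ¬ Tendsto y (𝓝[<] t) (𝓝 (x t))) :
    ∃ c > 0, ∀ t ∈ Icc 0 T, c ≤ dist (x t) (y t) := by
  have key : ∃ c > 0, ∀ t ∈ Icc 0 T, t ∈ Icc 0 T → c ≤ dist (x t) (y t) := by
    refine isCompact_Icc.induction_on (s := Icc 0 T)
      (p := fun s => ∃ c > 0, ∀ t ∈ s, t ∈ Icc 0 T → c ≤ dist (x t) (y t)) ?_ ?_ ?_ ?_
    · exact ⟨1, one_pos, fun t ht => ht.elim⟩
    · rintro s s' hs ⟨c, hc, h⟩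
      exact ⟨c, hc, fun t ht => h t (hs ht)⟩
    · rintro s s' ⟨c, hc, h⟩ ⟨c', hc', h'⟩
      refine ⟨min c c', lt_min hc hc', fun t ht htT => ?_⟩
      rcases ht with ht | ht
      · exact (min_le_left _ _).trans (h t ht htT)
      · exact (min_le_right _ _).trans (h' t ht htT)
    · intro t ht
      have hone : ∀ (l : Filter ℝ) (q : V), l ≤ 𝓝[Icc 0 T] t → Tendsto y l (𝓝 q) → x t ≠ q →
          ∃ c > 0, ∀ᶠ s in l, c ≤ dist (x s) (y s) := by
        intro l q hl hq hqne
        have hd : 0 < dist (x t) q := dist_pos.2 hqne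
        have h1 : Tendsto x l (𝓝 (x t)) := Tendsto.mono_left (hx t ht) hl
        exact ⟨dist (x t) q / 2, by linarith, ((h1.dist hq).eventually
          (lt_mem_nhds (show dist (x t) q / 2 < dist (x t) q by linarith))).mono fun s hs => hs.le⟩
      obtain ⟨c, hc, hcr⟩ := hone (𝓝[Icc 0 T ∩ Ici t] t) (y t)
        (nhdsWithin_mono t inter_subset_left)
        (Tendsto.mono_left (hy t ht) (nhdsWithin_mono t inter_subset_right)) (hne t ht)
      obtain ⟨c', hc', hcl⟩ : ∃ c > 0, ∀ᶠ s in 𝓝[Icc 0 T ∩ Iio t] t, c ≤ dist (x s) (y s) := by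
        rcases eq_or_lt_of_le ht.1 with rfl | h0
        · refine ⟨1, one_pos, ?_⟩
          have : Icc 0 T ∩ Iio (0 : ℝ) = ∅ := by
            ext s
            simp only [mem_inter_iff, mem_Icc, mem_Iio, mem_empty_iff_false, iff_false]
            rintro ⟨⟨h1, -⟩, h2⟩
            linarith
          rw [this, nhdsWithin_empty]
          exact eventually_bot
        · obtain ⟨q, hq⟩ := hleft t ⟨h0, ht.2⟩
          refine hone _ q (nhdsWithin_mono t inter_subset_left)
            (hq.mono_left (nhdsWithin_mono t inter_subset_right)) ?_
          rintro rfl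
          exact hne' t ⟨h0, ht.2⟩ hq
      have hunion : 𝓝[Icc 0 T] t = 𝓝[Icc 0 T ∩ Ici t] t ⊔ 𝓝[Icc 0 T ∩ Iio t] t := by
        rw [← nhdsWithin_union, ← inter_union_distrib_left, Ici_union_Iio, inter_univ]
      refine ⟨{s | min c c' ≤ dist (x s) (y s)}, ?_, min c c', lt_min hc hc', fun s hs _ => hs⟩
      rw [hunion]
      exact mem_sup.2 ⟨hcr.mono fun s hs => (min_le_left _ _).trans hs,
        hcl.mono fun s hs => (min_le_right _ _).trans hs⟩
  obtain ⟨c, hc, h⟩ := key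
  exact ⟨c, hc, fun t ht => h t ht ht⟩

theorem isArcChordDomain_of_sphere_of_cone {d : ℕ} {r δ α : ℝ}
    {D : Set (EuclideanSpace ℝ (Fin d))} (hDo : IsOpen D)
    (hDc : IsConnected D) (hr : UniformExteriorSphere D r) (hc : UniformInteriorCone D δ α) :
    IsArcChordDomain D where
  isOpen := hDo
  isConnected := hDc
  exists_le := by
    obtain ⟨s₀, hs₀, h⟩ := exists_intrinsicDist_le hDo hr hc
    exact ⟨s₀, hs₀, (r ^ 2)⁻¹, by positivity, h⟩

variable {d : ℕ} {D : Set (EuclideanSpace ℝ (Fin d))} [hD : IsArcChordDomain D]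

namespace IntrinsicClosure

section Chi

theorem isIntrinsicGeodesic_geod (hX : IsCAT0Space (IntrinsicClosure D))
    (x y : IntrinsicClosure D) :
    IsIntrinsicGeodesic D (fun t => (geod x y t).val) (dist x y) x.val y.val :=
  isIntrinsicGeodesic_val (geod_zero hX x y) (geod_dist hX x y)
    fun _ hs _ ht => dist_geod_geod hX hs ht

/-- Intrinsic geodesics are unique, since in a `CAT(0)` space a point is determined by its distances
from the ends of a geodesic if these add up to the length. -/
theorem _root_.IsIntrinsicGeodesic.eq_geod (hX : IsCAT0Space (IntrinsicClosure D))
    {x y : IntrinsicClosure D} {Γ : ℝ → EuclideanSpace ℝ (Fin d)} {L : ℝ}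
    (h : IsIntrinsicGeodesic D Γ L x.val y.val) :
    L = dist x y ∧ EqOn Γ (fun t => (geod x y t).val) (Icc 0 (dist x y)) := by
  have h0 : (0 : ℝ) ∈ Icc 0 L := ⟨le_rfl, h.nonneg⟩
  have h1 : L ∈ Icc 0 L := ⟨h.nonneg, le_rfl⟩
  have hL : L = dist x y := by
    have := h.dist_eq 0 h0 L h1
    rw [h.left, h.right, closureDist_val, zero_sub, abs_neg, abs_of_nonneg h.nonneg,
      ENNReal.ofReal_eq_ofReal_iff dist_nonneg h.nonneg] at this
    exact this.symm
  refine ⟨hL, fun t ht => ?_⟩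
  have ht' : t ∈ Icc 0 L := hL ▸ ht
  set p : IntrinsicClosure D := ⟨Γ t, h.mem t ht'⟩ with hp
  have e1 := h.dist_eq t ht' 0 h0
  have e2 := h.dist_eq t ht' L h1
  rw [h.left, sub_zero, abs_of_nonneg ht.1] at e1
  rw [h.right, abs_sub_comm, abs_of_nonneg (by linarith [ht'.2])] at e2
  have e3 : dist p x = t := by
    rw [dist_def, e1, ENNReal.toReal_ofReal ht.1]
  have e4 : dist p y = dist x y - t := by
    rw [dist_def, e2, ENNReal.toReal_ofReal (by linarith [ht'.2]), hL]
  exact congrArg val (_root_.eq_geod hX ht e3 e4)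

variable {s₀ C : ℝ} (hX : IsCAT0Space (IntrinsicClosure D))
  (hι : IsArcChordEmbedding (val : IntrinsicClosure D → EuclideanSpace ℝ (Fin d)) s₀ C)
include hX hι

theorem hasDerivWithinAt_geod {x y : IntrinsicClosure D} (hxy : x ≠ y) :
    HasDerivWithinAt (fun t => (geod x y t).val) (initialVelocity val x y)
      (Icc 0 (dist x y)) 0 := by
  have := pursues_geod hX hι (a := x) (b := y) (r := 0) (s := 0) le_rfl
    (by rwa [sub_zero, geod_zero hX])
  simp only [Pursues, sub_zero, geod_zero hX] at this
  exact this.mono Icc_subset_Ici_self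

/-- The field `chi` is the initial velocity of the geodesic. -/
theorem chi_eq {x y : IntrinsicClosure D} (hxy : x ≠ y) :
    chi D x.val y.val = initialVelocity val x y := by
  have hspec : ∃ (Γ : ℝ → EuclideanSpace ℝ (Fin d)) (L : ℝ),
      IsIntrinsicGeodesic D Γ L x.val y.val ∧
        HasDerivWithinAt Γ (chi D x.val y.val) (Icc 0 L) 0 :=
    Classical.epsilon_spec (p := fun v => ∃ (Γ : ℝ → EuclideanSpace ℝ (Fin d)) (L : ℝ),
      IsIntrinsicGeodesic D Γ L x.val y.val ∧ HasDerivWithinAt Γ v (Icc 0 L) 0)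
      ⟨_, _, _, isIntrinsicGeodesic_geod hX x y, hasDerivWithinAt_geod hX hι hxy⟩
  obtain ⟨Γ, L, hΓ, hderiv⟩ := hspec
  obtain ⟨rfl, heq⟩ := hΓ.eq_geod hX
  have h0 : (0 : ℝ) ∈ Icc 0 (dist x y) := ⟨le_rfl, dist_nonneg⟩
  exact (uniqueDiffOn_Icc (dist_pos.2 hxy) 0 h0).eq_deriv _ hderiv
    ((hasDerivWithinAt_geod hX hι hxy).congr heq (heq h0))

theorem norm_chi {x y : IntrinsicClosure D} (hxy : x ≠ y) : ‖chi D x.val y.val‖ = 1 := by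
  rw [chi_eq hX hι hxy, norm_initialVelocity hX hι hxy]

theorem exists_geodesic_hasDerivWithinAt_chi {x y : IntrinsicClosure D} (hxy : x ≠ y) :
    ∃ (Γ : ℝ → EuclideanSpace ℝ (Fin d)) (L : ℝ), IsIntrinsicGeodesic D Γ L x.val y.val ∧
      HasDerivWithinAt Γ (chi D x.val y.val) (Icc 0 L) 0 ∧
      ∀ (Γ' : ℝ → EuclideanSpace ℝ (Fin d)) (L' : ℝ),
        IsIntrinsicGeodesic D Γ' L' x.val y.val → L' = L ∧ EqOn Γ' Γ (Icc 0 L) := by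
  have hderiv := hasDerivWithinAt_geod hX hι hxy
  rw [← chi_eq hX hι hxy] at hderiv
  exact ⟨fun t => (geod x y t).val, dist x y, isIntrinsicGeodesic_geod hX x y, hderiv,
    fun _ _ h => h.eq_geod hX⟩

end Chi

open Classical in
/-- The point of the closure with given Euclidean position; the value `x₀` is taken if the position
is not in the closure. -/
noncomputable def ofPosition (x₀ : IntrinsicClosure D) (e : EuclideanSpace ℝ (Fin d)) :
    IntrinsicClosure D :=
  if h : e ∈ closure D then ⟨e, h⟩ else x₀

omit hD in
theorem val_ofPosition (x₀ : IntrinsicClosure D) {e : EuclideanSpace ℝ (Fin d)}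
    (h : e ∈ closure D) : (ofPosition x₀ e).val = e := by
  rw [ofPosition, dif_pos h]

section Bridge

variable {s₀ C : ℝ} (hX : IsCAT0Space (IntrinsicClosure D))
  (hι : IsArcChordEmbedding (val : IntrinsicClosure D → EuclideanSpace ℝ (Fin d)) s₀ C)
include hι

theorem continuousWithinAt_ofPosition (x₀ : IntrinsicClosure D)
    {f : ℝ → EuclideanSpace ℝ (Fin d)} {s : Set ℝ} {t : ℝ} (hf : ContinuousWithinAt f s t)
    (ht : t ∈ s) (hs : ∀ r ∈ s, f r ∈ closure D) :
    ContinuousWithinAt (fun r => ofPosition x₀ (f r)) s t := by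
  refine hι.tendsto_iff.2 ?_
  rw [val_ofPosition x₀ (hs t ht)]
  refine Tendsto.congr' ?_ hf
  filter_upwards [self_mem_nhdsWithin] with r hr
  exact (val_ofPosition x₀ (hs r hr)).symm

include hX

/-- Before meeting, a weak solution pursues the driving path in the sense of right derivatives, at
all times and not only almost everywhere. -/
theorem _root_.IsWeakSolution.pursues (x₀ : IntrinsicClosure D)
    {x y : ℝ → EuclideanSpace ℝ (Fin d)} {T : ℝ} (hT : 0 ≤ T) (hy : IsDrivingPath D y)
    (hx : IsWeakSolution D y x T) (hne : ∀ t ∈ Ico 0 T, x t ≠ y t) :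
    ContinuousOn (fun t => ofPosition x₀ (x t)) (Icc 0 T) ∧
    ∀ t ∈ Ico 0 T, ofPosition x₀ (x t) ≠ ofPosition x₀ (y t) ∧
      Pursues val (fun t => ofPosition x₀ (x t)) (ofPosition x₀ (y t)) t := by
  have hxc : ContinuousOn x (Icc 0 T) := by
    have := hx.absCont.continuousOn
    rwa [uIcc_of_le hT] at this
  have hUc : ContinuousOn (fun t => ofPosition x₀ (x t)) (Icc 0 T) := fun t ht =>
    continuousWithinAt_ofPosition hι x₀ (hxc t ht) ht hx.mem
  have hvx : ∀ t ∈ Icc 0 T, (ofPosition x₀ (x t)).val = x t := fun t ht =>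
    val_ofPosition x₀ (hx.mem t ht)
  have hvy : ∀ t, 0 ≤ t → (ofPosition x₀ (y t)).val = y t := fun t ht =>
    val_ofPosition x₀ (hy.mem t ht)
  have hne' : ∀ t ∈ Ico 0 T, ofPosition x₀ (x t) ≠ ofPosition x₀ (y t) := by
    intro t ht h
    have := congrArg val h
    rw [hvx t (Ico_subset_Icc_self ht), hvy t ht.1] at this
    exact hne t ht this
  have hchi : ∀ t ∈ Ico 0 T, chi D (x t) (y t) =
      initialVelocity val (ofPosition x₀ (x t)) (ofPosition x₀ (y t)) := by
    intro t ht
    rw [← chi_eq hX hι (hne' t ht), hvx t (Ico_subset_Icc_self ht), hvy t ht.1]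
  refine ⟨hUc, fun t ht => ⟨hne' t ht, ?_⟩⟩
  have hnhds : Ico t T ∈ 𝓝[≥] t := Ico_mem_nhdsGE ht.2
  have hsub : Ico t T ⊆ Ico 0 T := Ico_subset_Ico_left ht.1
  have htend : Tendsto (fun s => chi D (x s) (y s)) (𝓝[≥] t) (𝓝 (chi D (x t) (y t))) := by
    rw [hchi t ht]
    have h1 : Tendsto (fun s => ofPosition x₀ (x s)) (𝓝[≥] t) (𝓝 (ofPosition x₀ (x t))) :=
      (hUc t (Ico_subset_Icc_self ht)).mono_of_mem_nhdsWithin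
        (mem_of_superset hnhds (hsub.trans Ico_subset_Icc_self))
    have h2 : Tendsto (fun s => ofPosition x₀ (y s)) (𝓝[≥] t) (𝓝 (ofPosition x₀ (y t))) :=
      continuousWithinAt_ofPosition hι x₀ (hy.rightCont t ht.1) self_mem_Ici
        fun r hr => hy.mem r (ht.1.trans hr)
    refine Tendsto.congr' ?_ (tendsto_initialVelocity hX hι h1 h2 (hne' t ht))
    filter_upwards [hnhds] with s hs
    exact (hchi s (hsub hs)).symm
  have hint : IntervalIntegrable (fun s => chi D (x s) (y s)) volume 0 t :=
    hx.integrable.mono_set (by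
      rw [uIcc_of_le ht.1, uIcc_of_le hT]
      exact Icc_subset_Icc_right ht.2.le)
  have hmeas : StronglyMeasurableAtFilter (fun s => chi D (x s) (y s)) (𝓝[>] t) :=
    ⟨Ioc t T, Ioc_mem_nhdsGT ht.2,
      ((intervalIntegrable_iff_integrableOn_Ioc_of_le hT).1 hx.integrable).aestronglyMeasurable
        |>.mono_set (Ioc_subset_Ioc_left ht.1)⟩
  have hcw : ContinuousWithinAt (fun s => chi D (x s) (y s)) (Ioi t) t :=
    htend.mono_left (nhdsWithin_mono t Ioi_subset_Ici_self)
  have hderiv : HasDerivWithinAt (fun u => x 0 + ∫ s in (0 : ℝ)..u, chi D (x s) (y s))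
      (chi D (x t) (y t)) (Ici t) t :=
    (intervalIntegral.integral_hasDerivWithinAt_right hint hmeas hcw).const_add (x 0)
  unfold Pursues
  rw [← hchi t ht]
  have heq : ∀ s ∈ Icc 0 T, (ofPosition x₀ (x s)).val =
      x 0 + ∫ r in (0 : ℝ)..s, chi D (x r) (y r) := fun s hs => by rw [hvx s hs, ← hx.eqn s hs]
  refine hderiv.congr_of_eventuallyEq ?_ (heq t (Ico_subset_Icc_self ht))
  filter_upwards [hnhds] with s hs
  exact heq s (Ico_subset_Icc_self (hsub hs))

/-- A pursuing path is a weak solution. -/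
theorem isWeakSolution_of_pursues {y : ℝ → EuclideanSpace ℝ (Fin d)}
    {u w : ℝ → IntrinsicClosure D} {T : ℝ} (hT : 0 ≤ T) (hw : ∀ t, 0 ≤ t → (w t).val = y t)
    (huL : ∀ s, 0 ≤ s → ∀ t, 0 ≤ t → dist (u s) (u t) ≤ |s - t|)
    (hup : ∀ t ∈ Ico 0 T, u t ≠ w t ∧ Pursues val u (w t) t) :
    IsWeakSolution D y (fun t => (u t).val) T := by
  have hchi : ∀ t ∈ Ico 0 T, chi D (u t).val (y t) = initialVelocity val (u t) (w t) := by
    intro t ht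
    rw [← chi_eq hX hι (hup t ht).1, hw t ht.1]
  have hLip : LipschitzOnWith 1 (fun t => (u t).val) (uIcc 0 T) := by
    refine LipschitzOnWith.of_dist_le_mul fun s hs t ht => ?_
    rw [uIcc_of_le hT] at hs ht
    rw [NNReal.coe_one, one_mul, dist_eq_norm]
    exact (hι.norm_le _ _).trans (huL s hs.1 t ht.1)
  have hderiv : ∀ t ∈ Ico 0 T, HasDerivWithinAt (fun t => (u t).val) (chi D (u t).val (y t))
      (Ici t) t := fun t ht => hchi t ht ▸ (hup t ht).2
  have hint : IntervalIntegrable (fun s => chi D (u s).val (y s)) volume 0 T := by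
    rw [intervalIntegrable_iff_integrableOn_Ioo_of_le hT]
    -- the right derivative of any function is measurable
    have hmeas := (measurable_derivWithin_Ici (fun t => (u t).val)).stronglyMeasurable
    refine Integrable.of_bound (hmeas.aestronglyMeasurable.congr ?_) 1 ?_
    · filter_upwards [ae_restrict_mem measurableSet_Ioo] with t ht
      exact (hderiv t (Ioo_subset_Ico_self ht)).derivWithin (uniqueDiffWithinAt_Ici t)
    · filter_upwards [ae_restrict_mem measurableSet_Ioo] with t ht
      have ht' := Ioo_subset_Ico_self ht
      rw [hchi t ht', norm_initialVelocity hX hι (hup t ht').1]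
  refine ⟨fun t _ => (u t).mem, hLip.absolutelyContinuousOnInterval, hint, fun t ht => ?_⟩
  have hsub : uIcc 0 t ⊆ uIcc 0 T := by
    rw [uIcc_of_le ht.1, uIcc_of_le hT]
    exact Icc_subset_Icc_right ht.2
  rw [intervalIntegral.integral_eq_sub_of_hasDeriv_right (hLip.continuousOn.mono hsub) ?_
    (hint.mono_set hsub)]
  · abel
  · intro s hs
    rw [min_eq_left ht.1, max_eq_right ht.1] at hs
    exact (hderiv s ⟨hs.1.le, hs.2.trans_le ht.2⟩).mono Ioi_subset_Ici_self

/-- Existence and uniqueness up to the first meeting time. -/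
theorem exists_isPursuitPath {y : ℝ → EuclideanSpace ℝ (Fin d)} (hy : IsDrivingPath D y)
    {x₀ : EuclideanSpace ℝ (Fin d)} (hx₀ : x₀ ∈ closure D) :
    ∃ (x : ℝ → EuclideanSpace ℝ (Fin d)) (τ : ℝ≥0∞), x 0 = x₀ ∧ IsPursuitPath D y x τ ∧
      ∀ (z : ℝ → EuclideanSpace ℝ (Fin d)) (T : ℝ), 0 ≤ T → z 0 = x₀ →
        IsWeakSolution D y z T → (∀ t ∈ Ico 0 T, z t ≠ y t) →
        ENNReal.ofReal T ≤ τ ∧ EqOn z x (Icc 0 T) := by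
  set p₀ : IntrinsicClosure D := ⟨x₀, hx₀⟩ with hp₀
  set w : ℝ → IntrinsicClosure D := fun t => ofPosition p₀ (y t) with hw
  have hwv : ∀ t, 0 ≤ t → (w t).val = y t := fun t ht => val_ofPosition p₀ (hy.mem t ht)
  have hwc : ∀ t, 0 ≤ t → ContinuousWithinAt w (Ici t) t := fun t ht =>
    continuousWithinAt_ofPosition hι p₀ (hy.rightCont t ht) self_mem_Ici
      fun r hr => hy.mem r (ht.trans hr)
  obtain ⟨u, hu0, huL, hup⟩ := exists_pursuit hX hι hwc p₀
  have huc : ∀ s : Set ℝ, s ⊆ Ici 0 → ContinuousOn u s := by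
    intro s hs
    refine LipschitzOnWith.continuousOn (K := 1) (LipschitzOnWith.of_dist_le_mul ?_)
    intro r hr r' hr'
    simpa [Real.dist_eq] using huL r (hs hr) r' (hs hr')
  have hval : ∀ t, 0 ≤ t → ((u t).val = y t ↔ u t = w t) := fun t ht => by
    rw [← hwv t ht, IntrinsicClosure.ext_iff]
  set M : Set ℝ := {t | 0 ≤ t ∧ u t = w t} with hM
  have hsol : ∀ T, 0 ≤ T → (∀ t ∈ Ico 0 T, t ∉ M) → IsWeakSolution D y (fun t => (u t).val) T := by
    intro T hT hTM
    refine isWeakSolution_of_pursues hX hι hT hwv huL fun t ht => ?_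
    have hne : u t ≠ w t := fun h => hTM t ht ⟨ht.1, h⟩
    exact ⟨hne, hup t ht.1 hne⟩
  have hzu : ∀ (z : ℝ → EuclideanSpace ℝ (Fin d)) (T : ℝ), 0 ≤ T → z 0 = x₀ →
      IsWeakSolution D y z T → (∀ t ∈ Ico 0 T, z t ≠ y t) →
      EqOn z (fun t => (u t).val) (Icc 0 T) := by
    intro z T hT hz0 hz hne
    obtain ⟨hzc, hzp⟩ := hz.pursues hX hι p₀ hT hy hne
    have heq := eqOn_of_pursues hX hι (v := u) hzc (huc _ Icc_subset_Ici_self)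
      (fun t ht => hwc t ht.1) (by
        rw [hu0, hz0]
        exact IntrinsicClosure.ext (val_ofPosition p₀ hx₀)) hzp (fun t ht h => hup t ht.1 h)
    intro t ht
    have := congrArg val (heq ht)
    rwa [val_ofPosition p₀ (hz.mem t ht)] at this
  by_cases hMe : M.Nonempty
  · -- the first meeting time is attained, by right-continuity
    set σ := sInf M with hσ
    have hbdd : BddBelow M := ⟨0, fun t ht => ht.1⟩
    have hσ0 : 0 ≤ σ := le_csInf hMe fun t ht => ht.1
    have hlt : ∀ t, t < σ → t ∉ M := fun t ht hm => (csInf_le hbdd hm).not_gt ht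
    have hσM : u σ = w σ := by
      by_contra hne
      have hcu : Tendsto u (𝓝[≥] σ) (𝓝 (u σ)) :=
        huc (Ici σ) (Ici_subset_Ici.2 hσ0) σ self_mem_Ici
      have hev := (Tendsto.dist hcu (hwc σ hσ0)).eventually (lt_mem_nhds (dist_pos.2 hne))
      obtain ⟨c, hc, hsub⟩ := (mem_nhdsGE_iff_exists_Ico_subset' (lt_add_one σ)).1 hev
      obtain ⟨t, htM, htc⟩ := exists_lt_of_csInf_lt hMe (show sInf M < c from hc)
      have : 0 < dist (u t) (w t) := hsub ⟨csInf_le hbdd htM, htc⟩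
      exact (dist_pos.1 this) htM.2
    refine ⟨fun t => (u t).val, ENNReal.ofReal σ, by simp [hu0, hp₀], ⟨?_, ?_, ?_⟩, ?_⟩
    · intro T hT hTσ
      rw [ENNReal.ofReal_le_ofReal_iff hσ0] at hTσ
      exact hsol T hT fun t ht => hlt t (ht.2.trans_le hTσ)
    · intro t ht htσ
      rw [ENNReal.ofReal_lt_ofReal_iff_of_nonneg ht] at htσ
      rw [Ne, hval t ht]
      exact fun h => hlt t htσ ⟨ht, h⟩
    · intro t ht htσ
      rw [ENNReal.ofReal_eq_ofReal_iff ht hσ0] at htσ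
      exact (hval t ht).2 (htσ ▸ hσM)
    · intro z T hT hz0 hz hne
      have heq := hzu z T hT hz0 hz hne
      refine ⟨ENNReal.ofReal_le_ofReal ?_, heq⟩
      by_contra hcon
      push Not at hcon
      refine hne σ ⟨hσ0, hcon⟩ ?_
      rw [heq ⟨hσ0, hcon.le⟩]
      exact (hval σ hσ0).2 hσM
  · have hnot : ∀ t, t ∉ M := fun t ht => hMe ⟨t, ht⟩
    refine ⟨fun t => (u t).val, ⊤, by simp [hu0, hp₀], ⟨?_, ?_, ?_⟩, ?_⟩
    · intro T hT _
      exact hsol T hT fun t _ => hnot t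
    · intro t ht _
      rw [Ne, hval t ht]
      exact fun h => hnot t ⟨ht, h⟩
    · intro t _ h
      exact absurd h ENNReal.ofReal_ne_top
    · intro z T hT hz0 hz hne
      exact ⟨le_top, hzu z T hT hz0 hz hne⟩

/-- Continuous dependence up to the meeting times. Otherwise there would be solutions with
converging data that stay away from the given one. -/
theorem exists_dist_lt {y x : ℝ → EuclideanSpace ℝ (Fin d)} {τ : ℝ≥0∞} (hy : IsDrivingPath D y)
    (hx : IsPursuitPath D y x τ) {T : ℝ} (hT : 0 ≤ T) {ε : ℝ} (hε : 0 < ε) :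
    ∃ δ : ℝ, 0 < δ ∧
      ∀ (y' x' : ℝ → EuclideanSpace ℝ (Fin d)) (τ' : ℝ≥0∞), IsDrivingPath D y' →
        IsPursuitPath D y' x' τ' → dist (x' 0) (x 0) < δ →
        (∀ t ∈ Icc 0 T, dist (y' t) (y t) < δ) →
        ∀ t ∈ Icc 0 T, ENNReal.ofReal t ≤ τ → ENNReal.ofReal t ≤ τ' → dist (x' t) (x t) < ε := by
  by_contra hcon
  push Not at hcon
  choose y' x' τ' hy' hx' hstart htarget t ht htτ htτ' hfar using
    fun n : ℕ => hcon (1 / ((n : ℝ) + 1)) Nat.one_div_pos_of_nat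
  have hx00 : x 0 ∈ closure D :=
    (hx.sol 0 le_rfl (by simp)).mem 0 ⟨le_rfl, le_rfl⟩
  set p₀ : IntrinsicClosure D := ⟨x 0, hx00⟩ with hp₀
  -- the horizon: the smaller one of `T` and the meeting time
  obtain ⟨S, hS0, hST, hSτ, htS⟩ : ∃ S : ℝ, 0 ≤ S ∧ S ≤ T ∧ ENNReal.ofReal S ≤ τ ∧
      ∀ n, t n ∈ Icc 0 S := by
    rcases le_total (ENNReal.ofReal T) τ with h | h
    · exact ⟨T, hT, le_rfl, h, ht⟩
    · have hfin : τ ≠ ⊤ := ne_top_of_le_ne_top ENNReal.ofReal_ne_top h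
      refine ⟨τ.toReal, ENNReal.toReal_nonneg, ?_, (ENNReal.ofReal_toReal hfin).le, fun n =>
        ⟨(ht n).1, (ENNReal.ofReal_le_iff_le_toReal hfin).1 (htτ n)⟩⟩
      exact ENNReal.toReal_le_of_le_ofReal hT h
  have hpx := hx.sol S hS0 hSτ
  have hnx : ∀ r ∈ Ico 0 S, x r ≠ y r := fun r hr => hx.ne_before r hr.1
    (((ENNReal.ofReal_lt_ofReal_iff_of_nonneg hr.1).2 hr.2).trans_le hSτ)
  obtain ⟨hUc, hUp⟩ := hpx.pursues hX hι p₀ hS0 hy hnx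
  have hpx' : ∀ n, IsWeakSolution D (y' n) (x' n) (t n) := fun n =>
    (hx' n).sol _ (ht n).1 (htτ' n)
  have hnx' : ∀ n, ∀ r ∈ Ico 0 (t n), x' n r ≠ y' n r := fun n r hr => (hx' n).ne_before r hr.1
    (((ENNReal.ofReal_lt_ofReal_iff_of_nonneg hr.1).2 hr.2).trans_le (htτ' n))
  have hUp' := fun n => (hpx' n).pursues hX hι p₀ (ht n).1 (hy' n) (hnx' n)
  have hLip : ∀ {u w : ℝ → IntrinsicClosure D} {b : ℝ}, ContinuousOn u (Icc 0 b) →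
      (∀ r ∈ Ico 0 b, u r ≠ w r ∧ Pursues val u (w r) r) →
      ∀ r ∈ Icc 0 b, ∀ s ∈ Icc 0 b, dist (u r) (u s) ≤ |r - s| := by
    intro u w b hc hp r hr s hs
    have key : ∀ r ∈ Icc 0 b, ∀ s ∈ Icc 0 b, r ≤ s → dist (u r) (u s) ≤ s - r :=
      fun r hr s hs hrs => dist_le_sub_of_pursues hX hι hrs (hc.mono (Icc_subset_Icc hr.1 hs.2))
        fun q hq => hp q (Ico_subset_Ico hr.1 hs.2 hq)
    rcases le_total r s with h | h
    · rw [abs_sub_comm, abs_of_nonneg (by linarith)]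
      exact key r hr s hs h
    · rw [dist_comm, abs_of_nonneg (by linarith)]
      exact key s hs r hr h
  have hδ : Tendsto (fun n : ℕ => 1 / ((n : ℝ) + 1)) atTop (𝓝 0) :=
    tendsto_one_div_add_atTop_nhds_zero_nat
  have hmem' : ∀ n, x' n 0 ∈ closure D := fun n => (hpx' n).mem 0 ⟨le_rfl, (ht n).1⟩
  have key := tendsto_dist_of_pursues hX hι (l := atTop) (w := fun r => ofPosition p₀ (y r))
    (u := fun r => ofPosition p₀ (x r)) (S := S) (w' := fun n r => ofPosition p₀ (y' n r))
    (u' := fun n r => ofPosition p₀ (x' n r)) (τ := t)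
    (fun r hr => continuousWithinAt_ofPosition hι p₀ (hy.rightCont r hr.1) self_mem_Ici
      fun q hq => hy.mem q (hr.1.trans hq))
    (hLip hUc hUp) hUp htS (fun n => hLip (hUp' n).1 (hUp' n).2)
    (fun n r hr => ((hUp' n).2 r hr).2) ?_ ?_
  · obtain ⟨n, hn⟩ := (key.eventually (gt_mem_nhds hε)).exists
    have h1 := hι.norm_le (ofPosition p₀ (x' n (t n))) (ofPosition p₀ (x (t n)))
    rw [val_ofPosition p₀ ((hpx' n).mem _ ⟨(ht n).1, le_rfl⟩),
      val_ofPosition p₀ (hpx.mem _ (htS n)), ← dist_eq_norm] at h1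
    linarith [hfar n]
  · refine hι.tendsto_iff.2 ?_
    simp only [val_ofPosition p₀ (hmem' _), val_ofPosition p₀ hx00]
    exact tendsto_iff_dist_tendsto_zero.2
      (squeeze_zero (fun _ => dist_nonneg) (fun n => (hstart n).le) hδ)
  · intro η hη
    set K := 1 + C * s₀ ^ 2 with hK
    have hK0 : 0 < K := by have := hι.nonneg; positivity
    filter_upwards [hδ.eventually (gt_mem_nhds hι.pos),
      hδ.eventually (gt_mem_nhds (div_pos hη hK0))] with n h1 h2 r hr
    have hrT : r ∈ Icc 0 T := ⟨hr.1, hr.2.le.trans (ht n).2⟩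
    have h3 := htarget n r hrT
    rw [dist_eq_norm, ← val_ofPosition p₀ ((hy' n).mem r hr.1),
      ← val_ofPosition p₀ (hy.mem r hr.1)] at h3
    refine (hι.dist_le_mul _ _ (h3.trans h1).le).trans_lt ?_
    rw [← hK, mul_comm]
    exact (lt_div_iff₀ hK0).1 (h3.trans h2)

end Bridge

end IntrinsicClosure

end PursuitEquation

theorem proposition2p11 {d : ℕ} (hd : 2 ≤ d) (D : Set (EuclideanSpace ℝ (Fin d)))
    (hDopen : IsOpen D) (hDconn : IsConnected D) (hCAT0 : IsCAT0Domain D)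
    (hsphere : ∃ r : ℝ, UniformExteriorSphere D r)
    (hcone : ∃ δ α : ℝ, UniformInteriorCone D δ α) :
    -- the field `χ` is well defined off the diagonal, and consists of unit vectors
    (∀ x ∈ closure D, ∀ y ∈ closure D, x ≠ y →
      (∃ (Γ : ℝ → EuclideanSpace ℝ (Fin d)) (L : ℝ), IsIntrinsicGeodesic D Γ L x y ∧
        HasDerivWithinAt Γ (chi D x y) (Icc 0 L) 0 ∧
        ∀ (Γ' : ℝ → EuclideanSpace ℝ (Fin d)) (L' : ℝ),
          IsIntrinsicGeodesic D Γ' L' x y → L' = L ∧ EqOn Γ' Γ (Icc 0 L)) ∧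
      ‖chi D x y‖ = 1) ∧
    -- existence and uniqueness up to the first meeting time
    (∀ y : ℝ → EuclideanSpace ℝ (Fin d), IsDrivingPath D y → ∀ x₀ ∈ closure D,
      ∃ (x : ℝ → EuclideanSpace ℝ (Fin d)) (τ : ℝ≥0∞), x 0 = x₀ ∧ IsPursuitPath D y x τ ∧
        ∀ (z : ℝ → EuclideanSpace ℝ (Fin d)) (T : ℝ), 0 ≤ T → z 0 = x₀ →
          IsWeakSolution D y z T → (∀ t ∈ Ico 0 T, z t ≠ y t) →
          ENNReal.ofReal T ≤ τ ∧ EqOn z x (Icc 0 T)) ∧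
    -- continuous dependence on the initial value and on the driving path
    (∀ (y x : ℝ → EuclideanSpace ℝ (Fin d)) (τ : ℝ≥0∞), IsDrivingPath D y →
      IsPursuitPath D y x τ → ∀ T : ℝ, 0 ≤ T → ∀ ε : ℝ, 0 < ε → ∃ δ : ℝ, 0 < δ ∧
        ∀ (y' x' : ℝ → EuclideanSpace ℝ (Fin d)) (τ' : ℝ≥0∞), IsDrivingPath D y' →
          IsPursuitPath D y' x' τ' → dist (x' 0) (x 0) < δ →
          (∀ t ∈ Icc 0 T, dist (y' t) (y t) < δ) →
          (∀ t ∈ Icc 0 T, ENNReal.ofReal t ≤ τ → ENNReal.ofReal t ≤ τ' →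
            dist (x' t) (x t) < ε) ∧
          (ENNReal.ofReal T < τ → (∀ t ∈ Ioc 0 T, ¬ Tendsto y (𝓝[<] t) (𝓝 (x t))) →
            ENNReal.ofReal T < τ')) := by
  obtain ⟨r, hr⟩ := hsphere
  obtain ⟨δ, α, hc⟩ := hcone
  have hD : IsArcChordDomain D := isArcChordDomain_of_sphere_of_cone hDopen hDconn hr hc
  have hX := IntrinsicClosure.isCAT0Space hCAT0
  obtain ⟨s₀, C, hι⟩ := IntrinsicClosure.exists_isArcChordEmbedding (D := D)
  refine ⟨fun x hx y hy hxy => ?_, fun y hy x₀ hx₀ =>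
    IntrinsicClosure.exists_isPursuitPath hX hι hy hx₀, ?_⟩
  · have hne : (⟨x, hx⟩ : IntrinsicClosure D) ≠ ⟨y, hy⟩ := fun h =>
      hxy (congrArg IntrinsicClosure.val h)
    have h1 := IntrinsicClosure.exists_geodesic_hasDerivWithinAt_chi hX hι hne
    have h2 := IntrinsicClosure.norm_chi hX hι hne
    exact ⟨h1, h2⟩
  · intro y x τ hy hx T hT ε hε
    obtain ⟨δ₁, hδ₁, h₁⟩ := IntrinsicClosure.exists_dist_lt hX hι hy hx hT hε
    by_cases hsep : ENNReal.ofReal T < τ ∧ ∀ t ∈ Ioc 0 T, ¬ Tendsto y (𝓝[<] t) (𝓝 (x t))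
    · obtain ⟨hTτ, hleft⟩ := hsep
      have hxc : ContinuousOn x (Icc 0 T) := by
        have := (hx.sol T hT hTτ.le).absCont.continuousOn
        rwa [uIcc_of_le hT] at this
      obtain ⟨c, hc0, hsep⟩ := exists_pos_le_dist hxc (fun t ht => hy.rightCont t ht.1)
        (fun t ht => hy.leftLim t ht.1)
        (fun t ht => hx.ne_before t ht.1 ((ENNReal.ofReal_le_ofReal ht.2).trans_lt hTτ)) hleft
      obtain ⟨δ₂, hδ₂, h₂⟩ := IntrinsicClosure.exists_dist_lt hX hι hy hx hT
        (show 0 < c / 2 by linarith)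
      refine ⟨min δ₁ (min δ₂ (c / 2)), by positivity, fun y' x' τ' hy' hx' hstart htarget =>
        ⟨h₁ y' x' τ' hy' hx' (hstart.trans_le (min_le_left _ _))
          fun t ht => (htarget t ht).trans_le (min_le_left _ _), fun _ _ => ?_⟩⟩
      by_contra hcon
      push Not at hcon
      -- at the meeting time of the second pair the first pair would be too close
      have hfin : τ' ≠ ⊤ := ne_top_of_le_ne_top ENNReal.ofReal_ne_top hcon
      have hσ : ENNReal.ofReal τ'.toReal = τ' := ENNReal.ofReal_toReal hfin
      have hσT : τ'.toReal ∈ Icc 0 T :=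
        ⟨ENNReal.toReal_nonneg, ENNReal.toReal_le_of_le_ofReal hT hcon⟩
      have e1 := h₂ y' x' τ' hy' hx'
        (hstart.trans_le ((min_le_right _ _).trans (min_le_left _ _)))
        (fun t ht => (htarget t ht).trans_le ((min_le_right _ _).trans (min_le_left _ _)))
        τ'.toReal hσT (hσ.trans_le (hcon.trans hTτ.le)) hσ.le
      have e2 := (htarget _ hσT).trans_le ((min_le_right _ _).trans (min_le_right _ _))
      have e3 := hsep _ hσT
      have e4 := dist_triangle_left (x τ'.toReal) (y τ'.toReal) (x' τ'.toReal)
      rw [← hx'.eq_at τ'.toReal ENNReal.toReal_nonneg hσ] at e2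
      linarith
    · exact ⟨δ₁, hδ₁, fun y' x' τ' hy' hx' hstart htarget =>
        ⟨h₁ y' x' τ' hy' hx' hstart htarget, fun e1 e2 => absurd ⟨e1, e2⟩ hsep⟩⟩
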